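/- Let $X,Y$ be Polish spaces, let $c:X\times Y\to\mathbb R$ be a Borel function that is bounded below, and let $\mu,\nu$ be Borel probability measures on $X$ and $Y$. Let $\Gamma(\mu,\nu)$ be the set of Borel measures on $X\times Y$ with marginals $\mu$ and $\nu$, let $I_c$ be the set of pairs $(\phi,\psi)$ of functions $\phi:X\to\mathbb R$, $\psi:Y\to\mathbb R$ with $\psi(y)-\phi(x)\le c(x,y)$ for all $x\in X$, $y\in Y$, and put $$T^-\phi(y)=\inf_{x\in X}\{\phi(x)+c(x,y)\},\qquad T^+\psi(x)=\sup_{y\in Y}\{\psi(y)-c(x,y)\},\qquad \mathcal C(\mu,\nu)=\inf_{\pi\in\Gamma(\mu,\nu)}\int c\,d\pi .$$ Integrals with respect to $\pi\in\Gamma(\mu,\nu)$ are taken in $[-\infty,+\infty]$. We say that $\phi:X\to\mathbb R$ solves (K$^-$) if $\phi\in L^1(\mu)$, $T^-\phi$ is finite everywhere and belongs to $L^1(\nu)$, and $$\int_Y T^-\phi\,d\nu=\inf_{\pi\in\Gamma(\mu,\nu)}\int_{X\times Y}\big(\phi(x)+c(x,y)\big)\,d\pi ,$$ and that $\psi:Y\to\mathbb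 R$ solves (K$^+$) if $\psi\in L^1(\nu)$, $T^+\psi$ is finite everywhere and belongs to $L^1(\mu)$, and $$\int_X T^+\psi\,d\mu=\sup_{\pi\in\Gamma(\mu,\nu)}\int_{X\times Y}\big(\psi(y)-c(x,y)\big)\,d\pi .$$ A pair $(\phi,\psi)\in I_c$ with $\phi\in L^1(\mu)$, $\psi\in L^1(\nu)$ solves (KR) if it maximizes $\int_Y\psi\,d\nu-\int_X\phi\,d\mu$ among all such pairs. 1. If $\phi$ solves (K$^-$), then $(\phi,T^-\phi)\in I_c$ solves (KR), and $\int_Y T^-\phi\,d\nu-\int_X\phi\,d\mu=\mathcal C(\mu,\nu)$. Conversely, if $(\phi,\psi)\in I_c$ solves (KR), then $\phi$ solves (K$^-$). 2. If $\psi$ solves (K$^+$), then $(T^+\psi,\psi)\in I_c$ solves (KR), and $\int_Y\psi\,d\nu-\int_X T^+\psi\,d\mu=\mathcal C(\mu,\nu)$. Conversely, if $(\phi,\psi)\in I_c$ solves (KR), then $\psi$ solves (K$^+$). -/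

import Mathlib

open MeasureTheory

namespace KantorovichLaxOleinik

variable {X Y : Type*}

/-- The negative abstract Lax-Oleinik operator `T⁻φ(y) = inf_x (φ(x) + c(x,y))`. It is used only
for `φ` such that these infima are finite. -/
noncomputable def Tminus (c : X → Y → ℝ) (φ : X → ℝ) (y : Y) : ℝ := ⨅ x, (φ x + c x y)

/-- The positive abstract Lax-Oleinik operator `T⁺ψ(x) = sup_y (ψ(y) - c(x,y))`. It is used only
for `ψ` such that these suprema are finite. -/
noncomputable def Tplus (c : X → Y → ℝ) (ψ : Y → ℝ) (x : X) : ℝ := ⨆ y, (ψ y - c x y)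

/-- `I_c`: the pairs `(φ, ψ)` with `ψ(y) - φ(x) ≤ c(x,y)` for all `x` and `y`. -/
def admissiblePairs (c : X → Y → ℝ) : Set ((X → ℝ) × (Y → ℝ)) :=
  {p | ∀ x y, p.2 y - p.1 x ≤ c x y}

/-- The integral `∫ f⁺ - ∫ f⁻` with values in `[-∞, ∞]`; it is used only for functions one of whose
parts `f⁺`, `f⁻` has a finite integral. -/
noncomputable def extIntegral {Ω : Type*} [MeasurableSpace Ω] (π : Measure Ω) (f : Ω → ℝ) : EReal :=
  ((∫⁻ ω, ENNReal.ofReal (f ω) ∂π : ENNReal) : EReal) -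
    ((∫⁻ ω, ENNReal.ofReal (-f ω) ∂π : ENNReal) : EReal)

variable [MeasurableSpace X] [MeasurableSpace Y]

/-- `Γ(μ, ν)`: the transport plans between `μ` and `ν`. -/
def transportPlans (μ : Measure X) (ν : Measure Y) : Set (Measure (X × Y)) :=
  {π | π.map Prod.fst = μ ∧ π.map Prod.snd = ν}

/-- The optimal cost `C(μ, ν)` of the primal Kantorovich problem. -/
noncomputable def kantorovichCost (c : X → Y → ℝ) (μ : Measure X) (ν : Measure Y) : EReal :=
  ⨅ π ∈ transportPlans μ ν, extIntegral π (fun z => c z.1 z.2)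

/-- The objective `∫ ψ dν - ∫ φ dμ` of the dual Kantorovich problem. -/
noncomputable def dualValue (μ : Measure X) (ν : Measure Y) (φ : X → ℝ) (ψ : Y → ℝ) : ℝ :=
  ∫ y, ψ y ∂ν - ∫ x, φ x ∂μ

/-- `(φ, ψ) ∈ I_c` is a maximizer of the dual Kantorovich problem, among all the integrable pairs
in `I_c`. -/
def SolvesKR (c : X → Y → ℝ) (μ : Measure X) (ν : Measure Y) (φ : X → ℝ) (ψ : Y → ℝ) : Prop :=
  (φ, ψ) ∈ admissiblePairs c ∧ Integrable φ μ ∧ Integrable ψ ν ∧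
    ∀ φ' : X → ℝ, ∀ ψ' : Y → ℝ, (φ', ψ') ∈ admissiblePairs c → Integrable φ' μ → Integrable ψ' ν →
      dualValue μ ν φ' ψ' ≤ dualValue μ ν φ ψ

/-- `φ` solves `∫ T⁻φ dν = inf_π ∫ (φ(x) + c(x,y)) dπ`; here `φ` is integrable, and `T⁻φ` is
finite everywhere and integrable. -/
def SolvesKminus (c : X → Y → ℝ) (μ : Measure X) (ν : Measure Y) (φ : X → ℝ) : Prop :=
  Integrable φ μ ∧ (∀ y, BddBelow (Set.range fun x => φ x + c x y)) ∧ Integrable (Tminus c φ) ν ∧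
    ((∫ y, Tminus c φ y ∂ν : ℝ) : EReal) =
      ⨅ π ∈ transportPlans μ ν, extIntegral π (fun z => φ z.1 + c z.1 z.2)

/-- `ψ` solves `∫ T⁺ψ dμ = sup_π ∫ (ψ(y) - c(x,y)) dπ`; here `ψ` is integrable, and `T⁺ψ` is
finite everywhere and integrable. -/
def SolvesKplus (c : X → Y → ℝ) (μ : Measure X) (ν : Measure Y) (ψ : Y → ℝ) : Prop :=
  Integrable ψ ν ∧ (∀ x, BddAbove (Set.range fun y => ψ y - c x y)) ∧ Integrable (Tplus c ψ) μ ∧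
    ((∫ x, Tplus c ψ x ∂μ : ℝ) : EReal) =
      ⨆ π ∈ transportPlans μ ν, extIntegral π (fun z => ψ z.2 - c z.1 z.2)

end KantorovichLaxOleinik

/-!
Weak duality gives the first half of each part. The equation in `SolvesKminus` says that the pair
`(φ, T⁻φ)` has dual value `C(μ, ν)`, because adding `φ(x)` to the cost shifts every transport cost
by `∫ φ dμ`; no admissible pair has a larger value, so the pair is a maximizer.

The converse needs more than a maximizer: it needs `C(μ, ν) = ∫ ψ dν - ∫ φ dμ`, that is, the
absence of a duality gap for a Borel cost that is finite but neither bounded above nor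
semicontinuous. At a maximizer the reduced cost `d(x, y) = φ(x) + c(x, y) - ψ(y) ≥ 0` admits no
bounded pair `u(x) + w(y) ≤ d` of positive value, since it would improve `(φ, ψ)`. What has to be
shown is that `d` then has plans of arbitrarily small cost.

* For truncations of `d` this is duality for bounded Borel costs (`exists_plan_of_not_covered`). A
  reward with values in `[0, 1]` is viewed as its hypograph in `X × Y × [0, 1]`, and sets are
  measured by the price of the potentials covering them. This price is continuous along increasing
  unions (`Covered.iUnion`), because convex sets of potentials have almost everywhere convergent
  selections (`exists_ae_tendsto_pair`). Choquet's capacitability argument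
  (`exists_isCompact_of_not_range`) reduces the claim to a compact set, where the theorems of
  Hahn-Banach and Riesz produce the plan (`exists_measure_of_isCompact`).

* To pass from truncations to `d` itself (`exists_plan_lintegral_le`), finiteness of `d` is used
  in the following form: there are labels `a(x)` and `b(y)` such that `d ≤ a(x) + b(y)` outside a
  set with small sections. Plans for higher and higher truncations can be selected so that the
  laws of `(x, b(y))` and `(y, a(x))` converge in total variation on each level of the label.
  Hence on each block `{a = k, b = j}` a plan for a truncation high enough for that block can be
  used, and the pieces fit together up to a mass that remains small when weighted by the labels
  (`exists_partial_plan`). The mass that is left over is coupled inside `{d ≤ a + b}` by a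
  continuous version of the marriage lemma (`exists_plan_of_dense_relation`), at a cost bounded by
  the labels.

Plans of small reduced cost show that there is no gap. Disintegrating them over `Y` bounds
`T⁻φ - ψ` by functions of small integral, so that `T⁻φ = ψ` almost everywhere, although `T⁻φ` is not
known to be Borel; this gives both the integrability of `T⁻φ` and the equation for `φ`.

The second part is the first one for the cost `c(x, y)` read as a function on `Y × X` and the pair
`(-ψ, -φ)`.
-/

namespace KantorovichLaxOleinik

open Filter Topology Set
open scoped ENNReal NNReal

/-! ### Almost everywhere convergent selections from decreasing convex sets -/

/-- A decreasing sequence of nonempty bounded convex subsets of an inner product space has a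
Cauchy selection: vectors of almost minimal norm, by the parallelogram identity. -/
lemma exists_cauchySeq_of_antitone_convex {H : Type*} [NormedAddCommGroup H]
    [InnerProductSpace ℝ H] (C : ℕ → Set H) (hanti : Antitone C) (hconv : ∀ n, Convex ℝ (C n))
    (hne : ∀ n, (C n).Nonempty) (B : ℝ) (hB : ∀ n, ∀ v ∈ C n, ‖v‖ ^ 2 ≤ B) :
    ∃ v : ℕ → H, (∀ n, v n ∈ C n) ∧ CauchySeq v := by
  set d : ℕ → ℝ := fun n => sInf ((fun v => ‖v‖ ^ 2) '' C n) with hd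
  have hbdd : ∀ n, BddBelow ((fun v : H => ‖v‖ ^ 2) '' C n) := fun n =>
    ⟨0, by rintro _ ⟨v, -, rfl⟩; positivity⟩
  have hle : ∀ n, ∀ v ∈ C n, d n ≤ ‖v‖ ^ 2 := fun n v hv => csInf_le (hbdd n) ⟨v, hv, rfl⟩
  have hmono : Monotone d := fun m n hmn =>
    csInf_le_csInf (hbdd m) ((hne n).image _) (image_mono (hanti hmn))
  have hdB : BddAbove (range d) := ⟨B, by
    rintro _ ⟨n, rfl⟩
    obtain ⟨v, hv⟩ := hne n
    exact (hle n v hv).trans (hB n v hv)⟩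
  have hlim := tendsto_atTop_ciSup hmono hdB
  have hchoose : ∀ n : ℕ, ∃ v ∈ C n, ‖v‖ ^ 2 < d n + 1 / ((n : ℝ) + 1) := by
    intro n
    obtain ⟨_, ⟨v, hv, rfl⟩, h⟩ := exists_lt_of_csInf_lt ((hne n).image fun v => ‖v‖ ^ 2)
      (lt_add_of_pos_right (d n) (Nat.one_div_pos_of_nat (n := n)))
    exact ⟨v, hv, h⟩
  choose v hv hvd using hchoose
  refine ⟨v, hv, ?_⟩
  rw [Metric.cauchySeq_iff']
  intro ε hε
  have hup : ∀ n, d n ≤ ⨆ n, d n := le_ciSup hdB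
  have h1 : ∀ᶠ n in atTop, (⨆ n, d n) - ε ^ 2 / 16 < d n :=
    hlim.eventually (lt_mem_nhds (by linarith [show (0:ℝ) < ε ^ 2 / 16 by positivity]))
  have h2 : ∀ᶠ n : ℕ in atTop, 1 / ((n : ℝ) + 1) < ε ^ 2 / 16 :=
    tendsto_one_div_add_atTop_nhds_zero_nat.eventually (gt_mem_nhds (by positivity))
  obtain ⟨N, hN1, hN2⟩ := (h1.and h2).exists
  refine ⟨N, fun n hn => ?_⟩
  have hmem : (1 / 2 : ℝ) • v n + (1 / 2 : ℝ) • v N ∈ C N :=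
    hconv N (hanti hn (hv n)) (hv N) (by norm_num) (by norm_num) (by norm_num)
  have hmid := hle N _ hmem
  rw [← smul_add, norm_smul, mul_pow] at hmid
  have hpar := parallelogram_law_with_norm ℝ (v n) (v N)
  have hn2 : 1 / ((n : ℝ) + 1) ≤ 1 / ((N : ℝ) + 1) := by gcongr
  have := hvd n
  have := hvd N
  have := hup n
  have := hup N
  rw [dist_eq_norm]
  refine lt_of_pow_lt_pow_left₀ 2 hε.le ?_
  norm_num at hmid
  nlinarith [hmono hn, sq_nonneg ε]

/-- Komlós-type lemma in one space: decreasing convex sets of `[0, 1]`-valued functions have an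
almost everywhere convergent selection. -/
lemma exists_ae_tendsto_of_antitone_convex {Ω : Type*} [MeasurableSpace Ω] (m : Measure Ω)
    [SFinite m] (C : ℕ → Set (Ω → ℝ)) (hanti : Antitone C) (hconv : ∀ n, Convex ℝ (C n))
    (hne : ∀ n, (C n).Nonempty) (hmeas : ∀ n, ∀ f ∈ C n, Measurable f)
    (hIcc : ∀ n, ∀ f ∈ C n, ∀ ω, f ω ∈ Icc (0 : ℝ) 1) :
    ∃ f : ℕ → Ω → ℝ, (∀ n, f n ∈ C n) ∧
      ∀ᵐ ω ∂m, ∃ l, Tendsto (fun n => f n ω) atTop (𝓝 l) := by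
  set m' := m.toFinite
  have hLp : ∀ n, ∀ f ∈ C n, MemLp f 2 m' := fun n f hf =>
    MemLp.of_bound (hmeas n f hf).aestronglyMeasurable 1 (ae_of_all _ fun ω => by
      rw [Real.norm_eq_abs, abs_of_nonneg (hIcc n f hf ω).1]; exact (hIcc n f hf ω).2)
  let D : ℕ → Set (Lp ℝ 2 m') := fun n => {u | ∃ f, ∃ hf : f ∈ C n, u = (hLp n f hf).toLp f}
  obtain ⟨v, hv, hcau⟩ := exists_cauchySeq_of_antitone_convex D
    (by
      rintro i j hij u ⟨f, hf, rfl⟩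
      exact ⟨f, hanti hij hf, rfl⟩)
    (by
      rintro n _ ⟨f, hf, rfl⟩ _ ⟨g, hg, rfl⟩ s t hs ht hst
      exact ⟨s • f + t • g, hconv n hf hg hs ht hst, rfl⟩)
    (fun n => let ⟨f, hf⟩ := hne n; ⟨_, f, hf, rfl⟩)
    ((((m' univ) ^ ((2 : ℝ≥0∞).toReal⁻¹)).toReal) ^ 2)
    (by
      rintro n _ ⟨f, hf, rfl⟩
      have h1 : ‖(hLp n f hf).toLp f‖ ≤ ((m' univ) ^ ((2 : ℝ≥0∞).toReal⁻¹)).toReal := by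
        rw [Lp.norm_toLp]
        refine ENNReal.toReal_mono (ENNReal.rpow_ne_top_of_nonneg (by positivity)
          (measure_ne_top _ _)) ?_
        refine (eLpNorm_le_of_ae_bound (C := 1) (ae_of_all _ fun ω => ?_)).trans (by simp)
        rw [Real.norm_eq_abs, abs_of_nonneg (hIcc n f hf ω).1]; exact (hIcc n f hf ω).2
      gcongr)
  choose f hf hfv using hv
  obtain ⟨u, hu⟩ := cauchySeq_tendsto_of_complete hcau
  obtain ⟨ns, hns, hae⟩ := (tendstoInMeasure_of_tendsto_Lp hu).exists_seq_tendsto_ae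
  refine ⟨fun n => f (ns n), fun n => hanti (hns.id_le n) (hf (ns n)), ?_⟩
  have hcoe : ∀ᵐ ω ∂m', ∀ n, v n ω = f n ω := by
    rw [ae_all_iff]
    intro n
    rw [hfv n]
    exact MemLp.coeFn_toLp _
  rw [← ae_toFinite (μ := m)]
  filter_upwards [hae, hcoe] with ω h1 h2
  exact ⟨u ω, by simpa only [h2] using h1⟩

/-- Komlós-type lemma for pairs of functions on two spaces. -/
lemma exists_ae_tendsto_pair {Ω₁ Ω₂ : Type*} [MeasurableSpace Ω₁] [MeasurableSpace Ω₂]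
    (m₁ : Measure Ω₁) (m₂ : Measure Ω₂) [SFinite m₁] [SFinite m₂]
    (C : ℕ → Set ((Ω₁ → ℝ) × (Ω₂ → ℝ))) (hanti : Antitone C) (hconv : ∀ n, Convex ℝ (C n))
    (hne : ∀ n, (C n).Nonempty) (hmeas : ∀ n, ∀ f ∈ C n, Measurable f.1 ∧ Measurable f.2)
    (hIcc : ∀ n, ∀ f ∈ C n, (∀ ω, f.1 ω ∈ Icc (0 : ℝ) 1) ∧ ∀ ω, f.2 ω ∈ Icc (0 : ℝ) 1) :
    ∃ f : ℕ → (Ω₁ → ℝ) × (Ω₂ → ℝ), (∀ n, f n ∈ C n) ∧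
      (∀ᵐ ω ∂m₁, ∃ l, Tendsto (fun n => (f n).1 ω) atTop (𝓝 l)) ∧
      ∀ᵐ ω ∂m₂, ∃ l, Tendsto (fun n => (f n).2 ω) atTop (𝓝 l) := by
  obtain ⟨F, hF, hlim⟩ := exists_ae_tendsto_of_antitone_convex
    (m₁.map (Sum.inl : Ω₁ → Ω₁ ⊕ Ω₂) + m₂.map (Sum.inr : Ω₂ → Ω₁ ⊕ Ω₂))
    (fun n => {F | (F ∘ Sum.inl, F ∘ Sum.inr) ∈ C n})
    (fun i j hij F hF => hanti hij hF)
    (fun n F hF G hG s t hs ht hst => hconv n hF hG hs ht hst)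
    (fun n => by
      obtain ⟨⟨f, g⟩, h⟩ := hne n
      exact ⟨Sum.elim f g, by simpa using h⟩)
    (fun n F hF => by
      rw [← Sum.elim_comp_inl_inr F]
      exact Measurable.sumElim (hmeas n _ hF).1 (hmeas n _ hF).2)
    (fun n F hF => by
      rintro (ω | ω)
      · exact (hIcc n _ hF).1 ω
      · exact (hIcc n _ hF).2 ω)
  rw [ae_add_measure_iff] at hlim
  exact ⟨fun n => (F n ∘ Sum.inl, F n ∘ Sum.inr), hF,
    ae_of_ae_map measurable_inl.aemeasurable hlim.1,
    ae_of_ae_map measurable_inr.aemeasurable hlim.2⟩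

section Bounded

open scoped unitInterval BoundedContinuousFunction

/-! ### Duality for bounded Borel costs -/

/-- A set `E ⊆ X × Y × [0, 1]`, thought of as the hypograph of a reward, is covered at price `a`
if there are measurable `φ`, `ψ` with values in `[0, 1]` and `∫ φ dμ + ∫ ψ dν ≤ a` such that
`t ≤ φ(x) + ψ(y)` for all `(x, y, t) ∈ E`. -/
def Covered {X Y : Type*} [MeasurableSpace X] [MeasurableSpace Y] (μ : Measure X) (ν : Measure Y)
    (a : ℝ) (E : Set (X × Y × I)) : Prop :=
  ∃ φ : X → ℝ, ∃ ψ : Y → ℝ, Measurable φ ∧ Measurable ψ ∧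
    (∀ x, φ x ∈ Icc (0 : ℝ) 1) ∧ (∀ y, ψ y ∈ Icc (0 : ℝ) 1) ∧
    ∫ x, φ x ∂μ + ∫ y, ψ y ∂ν ≤ a ∧ ∀ z ∈ E, (z.2.2 : ℝ) ≤ φ z.1 + ψ z.2.1

section Covered

variable {X Y : Type*} [MeasurableSpace X] [MeasurableSpace Y] {μ : Measure X} {ν : Measure Y}
  {a : ℝ} {E E' : Set (X × Y × I)}

lemma Covered.mono (h : Covered μ ν a E') (hE : E ⊆ E') : Covered μ ν a E := by
  obtain ⟨φ, ψ, h1, h2, h3, h4, h5, h6⟩ := h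
  exact ⟨φ, ψ, h1, h2, h3, h4, h5, fun z hz => h6 z (hE hz)⟩

lemma integrable_of_mem_Icc {Ω : Type*} [MeasurableSpace Ω] {m : Measure Ω} [IsFiniteMeasure m]
    {f : Ω → ℝ} (hf : Measurable f) (h : ∀ ω, f ω ∈ Icc (0 : ℝ) 1) : Integrable f m :=
  Integrable.of_mem_Icc 0 1 hf.aemeasurable (ae_of_all _ h)

/-- If `[0, 1]`-valued functions converge almost everywhere, then their integrals converge to the
integral of the pointwise upper limit. -/
lemma tendsto_integral_limsup {Ω : Type*} [MeasurableSpace Ω] {m : Measure Ω} [IsFiniteMeasure m]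
    {f : ℕ → Ω → ℝ} (hf : ∀ n, Measurable (f n)) (h : ∀ n ω, f n ω ∈ Icc (0 : ℝ) 1)
    (hlim : ∀ᵐ ω ∂m, ∃ l, Tendsto (fun n => f n ω) atTop (𝓝 l)) :
    Tendsto (fun n => ∫ ω, f n ω ∂m) atTop (𝓝 (∫ ω, limsup (fun n => f n ω) atTop ∂m)) := by
  refine tendsto_integral_of_dominated_convergence (fun _ => 1)
    (fun n => (hf n).aestronglyMeasurable) (integrable_const _)
    (fun n => ae_of_all _ fun ω => ?_) ?_
  · rw [Real.norm_eq_abs, abs_of_nonneg (h n ω).1]; exact (h n ω).2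
  · filter_upwards [hlim] with ω ⟨l, hl⟩
    rwa [hl.limsup_eq]

lemma limsup_mem_Icc {u : ℕ → ℝ} (h : ∀ n, u n ∈ Icc (0 : ℝ) 1) :
    limsup u atTop ∈ Icc (0 : ℝ) 1 := by
  have hb : IsBoundedUnder (· ≤ ·) atTop u :=
    ⟨1, eventually_map.2 (Eventually.of_forall fun n => (h n).2)⟩
  have hb' : IsBoundedUnder (· ≥ ·) atTop u :=
    ⟨0, eventually_map.2 (Eventually.of_forall fun n => (h n).1)⟩
  exact ⟨le_limsup_of_frequently_le (Frequently.of_forall fun n => (h n).1) hb,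
    limsup_le_of_le hb'.isCoboundedUnder_le (Eventually.of_forall fun n => (h n).2)⟩

/-- Continuity from below of the covering price: here the convex combinations behind the
Komlós-type lemma are essential, since the potentials of the sets `E n` need not converge. -/
lemma Covered.iUnion [IsFiniteMeasure μ] [IsFiniteMeasure ν] {E : ℕ → Set (X × Y × I)}
    (hE : Monotone E) (h : ∀ n, Covered μ ν a (E n)) : Covered μ ν a (⋃ n, E n) := by
  let C : ℕ → Set ((X → ℝ) × (Y → ℝ)) := fun n => {p | Measurable p.1 ∧ Measurable p.2 ∧
    (∀ x, p.1 x ∈ Icc (0 : ℝ) 1) ∧ (∀ y, p.2 y ∈ Icc (0 : ℝ) 1) ∧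
    ∫ x, p.1 x ∂μ + ∫ y, p.2 y ∂ν ≤ a ∧ ∀ z ∈ E n, (z.2.2 : ℝ) ≤ p.1 z.1 + p.2 z.2.1}
  obtain ⟨f, hf, hl1, hl2⟩ := exists_ae_tendsto_pair μ ν C
    (by
      rintro i j hij p ⟨h1, h2, h3, h4, h5, h6⟩
      exact ⟨h1, h2, h3, h4, h5, fun z hz => h6 z (hE hij hz)⟩)
    (by
      rintro n p ⟨h1, h2, h3, h4, h5, h6⟩ q ⟨k1, k2, k3, k4, k5, k6⟩ s t hs ht hst
      refine ⟨(h1.const_smul s).add (k1.const_smul t), (h2.const_smul s).add (k2.const_smul t),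
        fun x => convex_Icc (0 : ℝ) 1 (h3 x) (k3 x) hs ht hst,
        fun y => convex_Icc (0 : ℝ) 1 (h4 y) (k4 y) hs ht hst, ?_, fun z hz => ?_⟩
      · have e1 : ∫ x, (s • p + t • q).1 x ∂μ = s * ∫ x, p.1 x ∂μ + t * ∫ x, q.1 x ∂μ := by
          rw [← integral_const_mul, ← integral_const_mul, ← integral_add]
          · rfl
          · exact (integrable_of_mem_Icc h1 h3).const_mul s
          · exact (integrable_of_mem_Icc k1 k3).const_mul t
        have e2 : ∫ y, (s • p + t • q).2 y ∂ν = s * ∫ y, p.2 y ∂ν + t * ∫ y, q.2 y ∂ν := by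
          rw [← integral_const_mul, ← integral_const_mul, ← integral_add]
          · rfl
          · exact (integrable_of_mem_Icc h2 h4).const_mul s
          · exact (integrable_of_mem_Icc k2 k4).const_mul t
        rw [e1, e2]
        have : a = s * a + t * a := by rw [← add_mul, hst, one_mul]
        nlinarith [mul_le_mul_of_nonneg_left h5 hs, mul_le_mul_of_nonneg_left k5 ht]
      · have := mul_le_mul_of_nonneg_left (h6 z hz) hs
        have := mul_le_mul_of_nonneg_left (k6 z hz) ht
        have e : (z.2.2 : ℝ) = s * z.2.2 + t * z.2.2 := by rw [← add_mul, hst, one_mul]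
        simp only [Prod.fst_add, Prod.smul_fst, Prod.snd_add, Prod.smul_snd, Pi.add_apply,
          Pi.smul_apply, smul_eq_mul]
        linarith)
    (fun n => by
      obtain ⟨φ, ψ, h⟩ := h n
      exact ⟨(φ, ψ), h⟩)
    (fun n p hp => ⟨hp.1, hp.2.1⟩) (fun n p hp => ⟨hp.2.2.1, hp.2.2.2.1⟩)
  have hm1 := fun n => (hf n).1
  have hm2 := fun n => (hf n).2.1
  have hI1 := fun n => (hf n).2.2.1
  have hI2 := fun n => (hf n).2.2.2.1
  refine ⟨fun x => limsup (fun n => (f n).1 x) atTop, fun y => limsup (fun n => (f n).2 y) atTop,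
    .limsup hm1, .limsup hm2, fun x => limsup_mem_Icc fun n => hI1 n x,
    fun y => limsup_mem_Icc fun n => hI2 n y, ?_, ?_⟩
  · exact le_of_tendsto' ((tendsto_integral_limsup hm1 hI1 hl1).add
      (tendsto_integral_limsup hm2 hI2 hl2)) fun n => (hf n).2.2.2.2.1
  · rintro z hz
    obtain ⟨m, hm⟩ := mem_iUnion.1 hz
    have hle : ∀ᶠ n in atTop, (z.2.2 : ℝ) ≤ (f n).1 z.1 + (f n).2 z.2.1 :=
      (eventually_ge_atTop m).mono fun n hn => (hf n).2.2.2.2.2 z (hE hn hm)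
    have b1 : IsBoundedUnder (· ≤ ·) atTop fun n => (f n).1 z.1 :=
      ⟨1, eventually_map.2 (Eventually.of_forall fun n => (hI1 n z.1).2)⟩
    have b2 : IsBoundedUnder (· ≤ ·) atTop fun n => (f n).2 z.2.1 :=
      ⟨1, eventually_map.2 (Eventually.of_forall fun n => (hI2 n z.2.1).2)⟩
    refine le_of_forall_pos_le_add fun ε hε => ?_
    have u1 := eventually_lt_of_limsup_lt (lt_add_of_pos_right _ (half_pos hε)) b1
    have u2 := eventually_lt_of_limsup_lt (lt_add_of_pos_right _ (half_pos hε)) b2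
    obtain ⟨n, h1, h2, h3⟩ := (hle.and (u1.and u2)).exists
    simp only at h1 h2 h3 ⊢
    linarith

end Covered

/-- Choquet's capacitability argument. If a monotone property that passes to increasing unions fails
for the continuous image of Baire space, then it fails for all neighborhoods of some compact subset
of that image. -/
lemma exists_isCompact_of_not_range {Z : Type*} [TopologicalSpace Z] (P : Set Z → Prop)
    (hmono : ∀ ⦃A B⦄, A ⊆ B → P B → P A)
    (hunion : ∀ E : ℕ → Set Z, Monotone E → (∀ n, P (E n)) → P (⋃ n, E n))
    (f : (ℕ → ℕ) → Z) (hf : Continuous f) (h : ¬ P (range f)) :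
    ∃ K, IsCompact K ∧ K ⊆ range f ∧ ∀ U, IsOpen U → K ⊆ U → ¬ P U := by
  -- `N l` is the set of sequences whose first terms are bounded by the entries of the list `l`
  let N : (ℕ → ℕ) → ℕ → Set (ℕ → ℕ) := fun s k => {x | ∀ i < k, x i ≤ s i}
  have hstep : ∀ (s : ℕ → ℕ) (k : ℕ), ¬ P (f '' N s k) →
      ∃ m, ¬ P (f '' (N s k ∩ {x | x k ≤ m})) := by
    intro s k hk
    by_contra! hcon
    refine hk (hmono ?_ (hunion (fun m => f '' (N s k ∩ {x | x k ≤ m})) ?_ hcon))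
    · rintro _ ⟨x, hx, rfl⟩
      exact mem_iUnion.2 ⟨x k, x, ⟨hx, le_refl (x k)⟩, rfl⟩
    · intro m m' hmm
      exact image_mono (inter_subset_inter_right _ fun x hx => le_trans hx hmm)
  choose! M hM using hstep
  -- the sequence of bounds is built by recursion on initial segments
  let S : ℕ → (ℕ → ℕ) := fun k => Nat.rec (fun _ => 0) (fun j s => Function.update s j (M s j)) k
  have hS : ∀ k, S (k + 1) = Function.update (S k) k (M (S k) k) := fun k => rfl
  let s : ℕ → ℕ := fun i => S (i + 1) i
  have hSs : ∀ k, ∀ i < k, S k i = s i := by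
    intro k
    induction k with
    | zero => intro i hi; omega
    | succ k ih =>
      intro i hi
      rcases Nat.lt_succ_iff_lt_or_eq.1 hi with h' | rfl
      · rw [hS, Function.update_of_ne h'.ne, ih i h']
      · rfl
  have hNS : ∀ k, N (S k) k = N s k := fun k => by
    ext x
    exact forall₂_congr fun i hi => by rw [hSs k i hi]
  have hnot : ∀ k, ¬ P (f '' N s k) := by
    intro k
    induction k with
    | zero =>
      have : N s 0 = univ := eq_univ_of_forall fun x i hi => absurd hi (Nat.not_lt_zero i)
      rwa [this, image_univ]
    | succ k ih =>
      rw [← hNS] at ih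
      refine fun hP => hM _ _ ih (hmono (image_mono ?_) hP)
      rintro x ⟨hx, hxk⟩ i hi
      rcases Nat.lt_succ_iff_lt_or_eq.1 hi with h' | rfl
      · rw [← hSs k i h']
        exact hx i h'
      · have : s i = M (S i) i := by simp [s, hS]
        rw [this]
        exact hxk
  let box : Set (ℕ → ℕ) := univ.pi fun i => Iic (s i)
  have hbox : IsCompact box := isCompact_univ_pi fun i => (finite_Iic (s i)).isCompact
  refine ⟨f '' box, hbox.image hf, image_subset_range _ _, fun U hU hKU hPU => ?_⟩
  have hV : IsOpen (f ⁻¹' U) := hU.preimage hf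
  suffices ∃ k, N s k ⊆ f ⁻¹' U by
    obtain ⟨k, hk⟩ := this
    exact hnot k (hmono (image_subset_iff.2 hk) hPU)
  by_contra! hcon
  have hex : ∀ k, ∃ x ∈ N s k, x ∉ f ⁻¹' U := fun k => not_subset.1 (hcon k)
  choose x hxN hxU using hex
  -- truncating the witnesses moves them into the compact box without changing initial segments
  obtain ⟨y, hy, ns, hns, hlim⟩ := hbox.tendsto_subseq (x := fun k i => min (x k i) (s i))
    fun k i _ => mem_Iic.2 (min_le_right _ _)
  have hlim' : Tendsto (fun j => x (ns j)) atTop (𝓝 y) := by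
    rw [tendsto_pi_nhds] at hlim ⊢
    intro i
    refine (hlim i).congr' ?_
    filter_upwards [eventually_gt_atTop i] with j hj
    exact min_eq_left (hxN (ns j) i (hj.trans_le (hns.id_le j)))
  obtain ⟨j, hj⟩ := (hlim'.eventually (hV.mem_nhds (hKU (mem_image_of_mem f hy)))).exists
  exact hxU _ hj

/-- Two finite Borel measures are comparable as soon as their integrals of nonnegative bounded
continuous functions are. -/
lemma measure_le_of_forall_integral_le {Z : Type*} [TopologicalSpace Z] [PolishSpace Z]
    [MeasurableSpace Z] [BorelSpace Z] {m m' : Measure Z} [IsFiniteMeasure m] [IsFiniteMeasure m']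
    (h : ∀ f : Z →ᵇ ℝ, (∀ z, 0 ≤ f z) → ∫ z, f z ∂m ≤ ∫ z, f z ∂m') : m ≤ m' := by
  let _ := TopologicalSpace.upgradeIsCompletelyMetrizable Z
  have hclosed : ∀ F : Set Z, IsClosed F → m F ≤ m' F := by
    intro F hF
    refine ge_of_tendsto' (HasOuterApproxClosed.tendsto_lintegral_apprSeq hF m') fun n => ?_
    refine (HasOuterApproxClosed.measure_le_lintegral hF m n).trans ?_
    let f : Z →ᵇ ℝ := BoundedContinuousFunction.comp _ NNReal.isometry_coe.lipschitz (hF.apprSeq n)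
    have hf0 : ∀ z, 0 ≤ f z := fun z => NNReal.coe_nonneg _
    have hof : ∀ q : Measure Z, [IsFiniteMeasure q] →
        ∫⁻ z, (hF.apprSeq n z : ℝ≥0∞) ∂q = ENNReal.ofReal (∫ z, f z ∂q) := by
      intro q _
      rw [ofReal_integral_eq_lintegral_ofReal (f.integrable q) (ae_of_all _ hf0)]
      refine lintegral_congr fun z => ?_
      exact (ENNReal.ofReal_coe_nnreal).symm
    rw [hof m, hof m']
    exact ENNReal.ofReal_le_ofReal (h f hf0)
  refine Measure.le_iff.2 fun s hs => ?_
  rw [hs.measure_eq_iSup_isClosed_of_ne_top (measure_ne_top m s)]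
  exact iSup₂_le fun F hFs => iSup_le fun hF => (hclosed F hF).trans (measure_mono hFs)

section Prices

variable {X Y : Type*} [TopologicalSpace X] [MeasurableSpace X] [TopologicalSpace Y]
  [MeasurableSpace Y] {μ : Measure X} {ν : Measure Y}

/-- The prices `∫ φ dμ + ∫ ψ dν` of the bounded continuous nonnegative potentials that dominate
a continuous function `h` on a compact set. -/
def continuousPrices (μ : Measure X) (ν : Measure Y) {K : Set (X × Y × I)} (h : C(K, ℝ)) : Set ℝ :=
  {r | ∃ φ : X →ᵇ ℝ, ∃ ψ : Y →ᵇ ℝ, (∀ x, 0 ≤ φ x) ∧ (∀ y, 0 ≤ ψ y) ∧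
    (∀ z : K, h z ≤ φ z.1.1 + ψ z.1.2.1) ∧ r = ∫ x, φ x ∂μ + ∫ y, ψ y ∂ν}

lemma zero_mem_lowerBounds_continuousPrices {K : Set (X × Y × I)} (h : C(K, ℝ)) :
    0 ∈ lowerBounds (continuousPrices μ ν h) := by
  rintro _ ⟨φ, ψ, h1, h2, -, rfl⟩
  exact add_nonneg (integral_nonneg h1) (integral_nonneg h2)

lemma smul_mem_continuousPrices {K : Set (X × Y × I)} {h : C(K, ℝ)} {s r : ℝ} (hs : 0 ≤ s)
    (hr : r ∈ continuousPrices μ ν h) : s * r ∈ continuousPrices μ ν (s • h) := by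
  obtain ⟨φ, ψ, h1, h2, h3, rfl⟩ := hr
  refine ⟨s • φ, s • ψ, fun x => mul_nonneg hs (h1 x), fun y => mul_nonneg hs (h2 y), fun z => ?_,
    ?_⟩
  · have := mul_le_mul_of_nonneg_left (h3 z) hs
    simp only [ContinuousMap.coe_smul, Pi.smul_apply, smul_eq_mul,
      BoundedContinuousFunction.coe_smul]
    linarith
  · simp only [BoundedContinuousFunction.coe_smul, smul_eq_mul, integral_const_mul]
    ring

lemma add_mem_continuousPrices [OpensMeasurableSpace X] [OpensMeasurableSpace Y]
    [IsFiniteMeasure μ] [IsFiniteMeasure ν] {K : Set (X × Y × I)} {h h' : C(K, ℝ)} {r r' : ℝ}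
    (hr : r ∈ continuousPrices μ ν h) (hr' : r' ∈ continuousPrices μ ν h') :
    r + r' ∈ continuousPrices μ ν (h + h') := by
  obtain ⟨φ, ψ, h1, h2, h3, rfl⟩ := hr
  obtain ⟨φ', ψ', h1', h2', h3', rfl⟩ := hr'
  refine ⟨φ + φ', ψ + ψ', fun x => add_nonneg (h1 x) (h1' x), fun y => add_nonneg (h2 y) (h2' y),
    fun z => ?_, ?_⟩
  · have := h3 z
    have := h3' z
    simp only [ContinuousMap.coe_add, Pi.add_apply, BoundedContinuousFunction.coe_add]
    linarith
  · simp only [BoundedContinuousFunction.coe_add, Pi.add_apply]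
    rw [integral_add (φ.integrable μ) (φ'.integrable μ), integral_add (ψ.integrable ν)
      (ψ'.integrable ν)]
    ring

lemma continuousPrices_nonempty {K : Set (X × Y × I)} [CompactSpace K] (h : C(K, ℝ)) :
    (continuousPrices μ ν h).Nonempty :=
  ⟨_, BoundedContinuousFunction.const X ‖h‖, 0, fun _ => norm_nonneg h, fun _ => le_rfl,
    fun z => by simpa using (le_abs_self _).trans (h.norm_coe_le_norm z), rfl⟩

end Prices

section Compact

variable {X Y : Type*} [TopologicalSpace X] [PolishSpace X] [MeasurableSpace X] [BorelSpace X]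
  [TopologicalSpace Y] [PolishSpace Y] [MeasurableSpace Y] [BorelSpace Y]
  {μ : Measure X} {ν : Measure Y} [IsProbabilityMeasure μ] [IsProbabilityMeasure ν]

/-- Duality on a compact set: by the Hahn-Banach theorem, the minimal price of the height function
is attained by a positive functional, which the Riesz representation theorem turns into a measure
whose marginals are dominated by `μ` and `ν`. -/
lemma exists_measure_of_isCompact {a : ℝ} {K : Set (X × Y × I)} (hK : IsCompact K)
    (h : ∀ U, IsOpen U → K ⊆ U → ¬ Covered μ ν a U) :
    ∃ ρ : Measure (X × Y × I), IsFiniteMeasure ρ ∧ ρ Kᶜ = 0 ∧ ρ.map Prod.fst ≤ μ ∧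
      ρ.map (fun z => z.2.1) ≤ ν ∧ a ≤ ∫ z, (z.2.2 : ℝ) ∂ρ := by
  rcases le_or_gt a 0 with ha | ha
  · exact ⟨0, inferInstance, by simp, by simp [Measure.zero_le],
      by simp [Measure.zero_le], by simpa⟩
  have : CompactSpace K := isCompact_iff_compactSpace.1 hK
  let τ : C(K, ℝ) := ⟨fun z => (z.1.2.2 : ℝ), by fun_prop⟩
  let N : C(K, ℝ) → ℝ := fun f => sInf (continuousPrices μ ν f)
  have hbdd : ∀ f : C(K, ℝ), BddBelow (continuousPrices μ ν f) := fun f =>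
    ⟨0, zero_mem_lowerBounds_continuousPrices f⟩
  have hN0 : ∀ f, 0 ≤ N f := fun f =>
    le_csInf (continuousPrices_nonempty f) (zero_mem_lowerBounds_continuousPrices f)
  have hNle : ∀ s : ℝ, 0 < s → ∀ f, N (s • f) ≤ s * N f := by
    intro s hs f
    rw [← div_le_iff₀' hs]
    refine le_csInf (continuousPrices_nonempty f) fun r hr => ?_
    rw [div_le_iff₀' hs]
    exact csInf_le (hbdd _) (smul_mem_continuousPrices hs.le hr)
  have hNhom : ∀ s : ℝ, 0 < s → ∀ f, N (s • f) = s * N f := by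
    intro s hs f
    refine le_antisymm (hNle s hs f) ?_
    have := hNle s⁻¹ (inv_pos.2 hs) (s • f)
    rw [smul_smul, inv_mul_cancel₀ hs.ne', one_smul] at this
    calc s * N f ≤ s * (s⁻¹ * N (s • f)) := by gcongr
      _ = N (s • f) := by field_simp
  have hNadd : ∀ f g, N (f + g) ≤ N f + N g := by
    intro f g
    rw [← csInf_add (continuousPrices_nonempty f) (hbdd f) (continuousPrices_nonempty g) (hbdd g)]
    refine csInf_le_csInf (hbdd _)
      ((continuousPrices_nonempty f).add (continuousPrices_nonempty g)) ?_
    rintro _ ⟨r, hr, r', hr', rfl⟩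
    exact add_mem_continuousPrices hr hr'
  have haN : a ≤ N τ := by
    refine le_csInf (continuousPrices_nonempty τ) ?_
    rintro _ ⟨φ, ψ, h1, h2, h3, rfl⟩
    refine le_of_forall_pos_le_add fun ε hε => ?_
    -- enlarging `φ` by `ε` covers a neighborhood of `K`
    by_contra! hlt
    refine h {z | (z.2.2 : ℝ) < φ z.1 + ε + ψ z.2.1} (isOpen_lt (by fun_prop) (by fun_prop))
      (fun z hz => by
        have := h3 ⟨z, hz⟩
        simp only [τ, ContinuousMap.coe_mk] at this
        simp only [mem_ofPred_eq]
        linarith)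
      ⟨fun x => min (φ x + ε) 1, fun y => min (ψ y) 1, ?_, ?_, ?_, ?_, ?_, ?_⟩
    · exact (φ.continuous.measurable.add_const ε).min measurable_const
    · exact ψ.continuous.measurable.min measurable_const
    · exact fun x => ⟨le_min (by linarith [h1 x]) zero_le_one, min_le_right _ _⟩
    · exact fun y => ⟨le_min (h2 y) zero_le_one, min_le_right _ _⟩
    · have i1 : ∫ x, min (φ x + ε) 1 ∂μ ≤ ∫ x, (φ x + ε) ∂μ :=
        integral_mono_of_nonneg (ae_of_all _ fun x => le_min (add_nonneg (h1 x) hε.le) zero_le_one)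
          ((φ.integrable μ).add (integrable_const ε)) (ae_of_all _ fun x => min_le_left _ _)
      have i2 : ∫ y, min (ψ y) 1 ∂ν ≤ ∫ y, ψ y ∂ν :=
        integral_mono_of_nonneg (ae_of_all _ fun y => le_min (h2 y) zero_le_one)
          (ψ.integrable ν) (ae_of_all _ fun y => min_le_left _ _)
      rw [integral_add (φ.integrable μ) (integrable_const ε)] at i1
      simp only [integral_const, probReal_univ, smul_eq_mul, one_mul] at i1
      linarith
    · intro z hz
      have hz1 : (z.2.2 : ℝ) ≤ 1 := z.2.2.2.2
      have hz2 : (z.2.2 : ℝ) < φ z.1 + ε + ψ z.2.1 := hz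
      have := h1 z.1
      have := h2 z.2.1
      rcases le_total (φ z.1 + ε) 1 with c1 | c1 <;> rcases le_total (ψ z.2.1) 1 with c2 | c2 <;>
        simp only [c1, c2, min_eq_left, min_eq_right] <;> linarith
  have hτ : τ ≠ 0 := by
    intro h0
    have : (0 : ℝ) ∈ continuousPrices μ ν τ := by
      rw [h0]
      exact ⟨0, 0, by simp, by simp, by simp, by simp⟩
    linarith [csInf_le (hbdd τ) this]
  -- a functional below `N` is automatically positive, since `N (-f) ≤ 0` for `f ≥ 0`
  obtain ⟨Λ, hΛτ, hΛN⟩ := exists_extension_of_le_sublinear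
    (LinearPMap.mkSpanSingleton τ (N τ) hτ) N hNhom hNadd (by
      rintro ⟨f, hf⟩
      obtain ⟨s, rfl⟩ := Submodule.mem_span_singleton.1 hf
      rw [LinearPMap.mkSpanSingleton'_apply]
      rcases le_or_gt s 0 with hs | hs
      · exact (mul_nonpos_of_nonpos_of_nonneg hs (hN0 τ)).trans (hN0 _)
      · exact (hNhom s hs τ).ge)
  have hΛτ' : Λ τ = N τ := by
    have := hΛτ ⟨τ, Submodule.mem_span_singleton_self τ⟩
    rwa [LinearPMap.mkSpanSingleton_apply] at this
  have hΛpos : ∀ f : C(K, ℝ), 0 ≤ f → 0 ≤ Λ f := by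
    intro f hf
    have h1 : (0 : ℝ) ∈ continuousPrices μ ν (-f) :=
      ⟨0, 0, by simp, by simp, fun z => by simpa using hf z, by simp⟩
    have h2 := (hΛN (-f)).trans (csInf_le (hbdd _) h1)
    rw [map_neg] at h2
    linarith
  let Λc : CompactlySupportedContinuousMap K ℝ →ₚ[ℝ] ℝ := PositiveLinearMap.mk₀
    { toFun := fun f => Λ f.toContinuousMap
      map_add' := fun f g => Λ.map_add f.toContinuousMap g.toContinuousMap
      map_smul' := fun s f => Λ.map_smul s f.toContinuousMap }
    fun f hf => hΛpos f.toContinuousMap hf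
  let ρK : Measure K := RealRMK.rieszMeasure Λc
  have hint : ∀ f : C(K, ℝ), ∫ z, f z ∂ρK = Λ f := fun f =>
    RealRMK.integral_rieszMeasure Λc (CompactlySupportedContinuousMap.continuousMapEquiv f)
  have : IsFiniteMeasure ρK := by
    have : ρK.Regular := RealRMK.regular_rieszMeasure Λc
    infer_instance
  let ρ : Measure (X × Y × I) := ρK.map Subtype.val
  have hρint : ∀ f : X × Y × I → ℝ, Continuous f → ∫ z, f z ∂ρ = ∫ z : K, f z ∂ρK := fun f hf =>
    integral_map measurable_subtype_coe.aemeasurable hf.aestronglyMeasurable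
  refine ⟨ρ, inferInstance, ?_, ?_, ?_, ?_⟩
  · rw [Measure.map_apply measurable_subtype_coe hK.measurableSet.compl]
    simp
  · refine measure_le_of_forall_integral_le fun φ hφ => ?_
    rw [integral_map measurable_fst.aemeasurable φ.continuous.aestronglyMeasurable,
      hρint (fun z => φ z.1) (φ.continuous.comp continuous_fst)]
    have := hint ⟨fun z => φ z.1.1, by fun_prop⟩
    simp only [ContinuousMap.coe_mk] at this
    rw [this]
    refine (hΛN _).trans (csInf_le (hbdd _) ⟨φ, 0, hφ, by simp, by simp, by simp⟩)
  · have hm : Measurable fun z : X × Y × I => z.2.1 := by fun_prop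
    refine measure_le_of_forall_integral_le fun ψ hψ => ?_
    rw [integral_map hm.aemeasurable ψ.continuous.aestronglyMeasurable,
      hρint (fun z => ψ z.2.1) (by fun_prop)]
    have := hint ⟨fun z => ψ z.1.2.1, by fun_prop⟩
    simp only [ContinuousMap.coe_mk] at this
    rw [this]
    refine (hΛN _).trans (csInf_le (hbdd _) ⟨0, ψ, by simp, hψ, by simp, by simp⟩)
  · rw [hρint _ (by fun_prop)]
    exact haN.trans (hΛτ'.symm.trans (hint τ).symm).le

end Compact

section Plans

variable {X Y : Type*} [MeasurableSpace X] [MeasurableSpace Y]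

lemma measure_univ_eq_of_mem_transportPlans {μ : Measure X} {ν : Measure Y} {π : Measure (X × Y)}
    (h : π ∈ transportPlans μ ν) : π univ = μ univ := by
  rw [← h.1, Measure.map_apply measurable_fst .univ, preimage_univ]

lemma exists_mem_transportPlans (μ : Measure X) (ν : Measure Y) [IsFiniteMeasure μ]
    [IsFiniteMeasure ν] (h : μ univ = ν univ) : ∃ π, π ∈ transportPlans μ ν := by
  rcases eq_or_ne (μ univ) 0 with h0 | h0
  · refine ⟨0, ?_, ?_⟩
    · exact (Measure.map_zero _).trans (Measure.measure_univ_eq_zero.1 h0).symm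
    · exact (Measure.map_zero _).trans (Measure.measure_univ_eq_zero.1 (h ▸ h0)).symm
  · refine ⟨(μ univ)⁻¹ • μ.prod ν, ?_, ?_⟩
    · rw [Measure.map_smul, Measure.map_fst_prod, ← h, smul_smul,
        ENNReal.inv_mul_cancel h0 (measure_ne_top _ _), one_smul]
    · rw [Measure.map_smul, Measure.map_snd_prod, smul_smul,
        ENNReal.inv_mul_cancel h0 (measure_ne_top _ _), one_smul]

lemma add_mem_transportPlans {μ μ' : Measure X} {ν ν' : Measure Y} {π π' : Measure (X × Y)}
    (h : π ∈ transportPlans μ ν) (h' : π' ∈ transportPlans μ' ν') :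
    π + π' ∈ transportPlans (μ + μ') (ν + ν') := by
  constructor
  · rw [Measure.map_add _ _ measurable_fst, h.1, h'.1]
  · rw [Measure.map_add _ _ measurable_snd, h.2, h'.2]

lemma exists_le_mem_transportPlans {μ : Measure X} {ν : Measure Y} [IsProbabilityMeasure μ]
    [IsProbabilityMeasure ν] {ρ : Measure (X × Y)} (h1 : ρ.map Prod.fst ≤ μ)
    (h2 : ρ.map Prod.snd ≤ ν) : ∃ π ∈ transportPlans μ ν, ρ ≤ π := by
  have f1 : IsFiniteMeasure (ρ.map Prod.fst) := isFiniteMeasure_of_le μ h1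
  have f2 : IsFiniteMeasure (ρ.map Prod.snd) := isFiniteMeasure_of_le ν h2
  have e1 := Measure.sub_add_cancel_of_le h1
  have e2 := Measure.sub_add_cancel_of_le h2
  have hmass : (ρ.map Prod.fst) univ = (ρ.map Prod.snd) univ := by
    rw [Measure.map_apply measurable_fst .univ, Measure.map_apply measurable_snd .univ,
      preimage_univ, preimage_univ]
  obtain ⟨τ, hτ⟩ := exists_mem_transportPlans (μ - ρ.map Prod.fst) (ν - ρ.map Prod.snd) (by
    have m1 := congrArg (· univ) e1
    have m2 := congrArg (· univ) e2
    simp only [Measure.coe_add, Pi.add_apply, measure_univ] at m1 m2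
    rw [← hmass] at m2
    exact (ENNReal.add_left_inj (measure_ne_top _ _)).1 (m1.trans m2.symm))
  refine ⟨τ + ρ, ?_, Measure.le_add_left le_rfl⟩
  have := add_mem_transportPlans hτ (show ρ ∈ transportPlans _ _ from ⟨rfl, rfl⟩)
  rwa [e1, e2] at this

end Plans

section BoundedDuality

variable {X Y : Type*} [TopologicalSpace X] [PolishSpace X] [MeasurableSpace X] [BorelSpace X]
  [TopologicalSpace Y] [PolishSpace Y] [MeasurableSpace Y] [BorelSpace Y]
  {μ : Measure X} {ν : Measure Y} [IsProbabilityMeasure μ] [IsProbabilityMeasure ν]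

/-- Duality for a Borel reward `g` with values in `[0, 1]`: if no pair of potentials covers `g` at
price `a`, then some plan has reward at least `a`. -/
lemma exists_plan_of_not_covered {g : X × Y → ℝ} (hg : Measurable g)
    (hg01 : ∀ z, g z ∈ Icc (0 : ℝ) 1) {a : ℝ}
    (h : ¬ Covered μ ν a {z : X × Y × I | (z.2.2 : ℝ) ≤ g (z.1, z.2.1)}) :
    ∃ π ∈ transportPlans μ ν, a ≤ ∫ z, g z ∂π := by
  set E := {z : X × Y × I | (z.2.2 : ℝ) ≤ g (z.1, z.2.1)} with hE
  have hEmeas : MeasurableSet E := measurableSet_le (by fun_prop) (by fun_prop)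
  have hana : AnalyticSet E := hEmeas.analyticSet
  rw [AnalyticSet] at hana
  obtain ⟨K, hK, hKE, hKU⟩ : ∃ K, IsCompact K ∧ K ⊆ E ∧
      ∀ U, IsOpen U → K ⊆ U → ¬ Covered μ ν a U := by
    rcases hana with h0 | ⟨f, hf, hfE⟩
    · refine ⟨∅, isCompact_empty, empty_subset _, fun U _ _ hU => h (hU.mono ?_)⟩
      rw [h0]
      exact empty_subset _
    · rw [← hfE] at h ⊢
      exact exists_isCompact_of_not_range (Covered μ ν a) (fun A B hAB hB => hB.mono hAB)
        (fun E hE hc => Covered.iUnion hE hc) f hf h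
  obtain ⟨ρ, hρ, hρK, hρ1, hρ2, hρa⟩ := exists_measure_of_isCompact hK hKU
  let p : X × Y × I → X × Y := fun z => (z.1, z.2.1)
  have hp : Measurable p := by fun_prop
  obtain ⟨π, hπ, hle⟩ := exists_le_mem_transportPlans (μ := μ) (ν := ν) (ρ := ρ.map p)
    (by rwa [Measure.map_map measurable_fst hp]) (by rwa [Measure.map_map measurable_snd hp])
  have hπf : IsFiniteMeasure π := ⟨by
    rw [measure_univ_eq_of_mem_transportPlans hπ]; exact measure_lt_top _ _⟩
  refine ⟨π, hπ, hρa.trans ?_⟩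
  calc ∫ z, (z.2.2 : ℝ) ∂ρ ≤ ∫ z, g (p z) ∂ρ := by
        refine integral_mono_of_nonneg (ae_of_all _ fun z => z.2.2.2.1)
          (integrable_of_mem_Icc (hg.comp hp) fun z => hg01 _) ?_
        have : ∀ᵐ z ∂ρ, z ∈ K := hρK
        filter_upwards [this] with z hz using hKE hz
    _ = ∫ z, g z ∂(ρ.map p) := (integral_map hp.aemeasurable hg.aestronglyMeasurable).symm
    _ ≤ ∫ z, g z ∂π := integral_mono_measure hle (ae_of_all _ fun z => (hg01 z).1)
        (integrable_of_mem_Icc hg hg01)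

/-- If no bounded pair of potentials below the cost `c` has positive value, then every truncation
of `c` has plans of arbitrarily small cost. -/
lemma exists_plan_lintegral_min_le {c : X × Y → ℝ≥0} (hc : Measurable c)
    (hdual : ∀ u : X → ℝ, ∀ w : Y → ℝ, Measurable u → Measurable w → (∃ B, ∀ x, |u x| ≤ B) →
      (∃ B, ∀ y, |w y| ≤ B) → (∀ x y, u x + w y ≤ c (x, y)) → ∫ x, u x ∂μ + ∫ y, w y ∂ν ≤ 0)
    (n : ℕ) {ε : ℝ≥0∞} (hε : ε ≠ 0) :
    ∃ π ∈ transportPlans μ ν, ∫⁻ z, min (c z : ℝ≥0∞) n ∂π ≤ ε := by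
  obtain ⟨δ, hδ0, hδ⟩ : ∃ δ : ℝ, 0 < δ ∧ ENNReal.ofReal δ ≤ ε := by
    obtain ⟨δ, h1, h2⟩ := ENNReal.lt_iff_exists_nnreal_btwn.1 (pos_iff_ne_zero.2 hε)
    exact ⟨δ, by exact_mod_cast h1, by simpa using h2.le⟩
  set m : ℝ := n + 1 with hm
  have hm0 : 0 < m := by positivity
  let g : X × Y → ℝ := fun z => 1 - min (c z : ℝ) m / m
  have hg : Measurable g := by fun_prop
  have hg01 : ∀ z, g z ∈ Icc (0 : ℝ) 1 := by
    intro z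
    have h1 : 0 ≤ min (c z : ℝ) m / m := by positivity
    have h2 : min (c z : ℝ) m / m ≤ 1 := (div_le_one hm0).2 (min_le_right _ _)
    exact ⟨by simp only [g]; linarith, by simp only [g]; linarith⟩
  obtain ⟨π, hπ, hle⟩ := exists_plan_of_not_covered (μ := μ) (ν := ν) hg hg01 (a := 1 - δ / m) (by
    rintro ⟨φ, ψ, h1, h2, h3, h4, h5, h6⟩
    have := hdual (fun x => m * (1 - φ x)) (fun y => -(m * ψ y)) (by fun_prop) (by fun_prop)
      ⟨m, fun x => by
        rw [abs_mul, abs_of_pos hm0, abs_of_nonneg (by linarith [(h3 x).2])]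
        nlinarith [(h3 x).1]⟩
      ⟨m, fun y => by
        rw [abs_neg, abs_mul, abs_of_pos hm0, abs_of_nonneg (h4 y).1]
        nlinarith [(h4 y).2]⟩
      (fun x y => by
        have := h6 (x, y, ⟨g (x, y), hg01 _⟩) (le_refl (g (x, y)))
        simp only [g] at this
        have h7 : min (c (x, y) : ℝ) m / m * m ≤ c (x, y) := by
          rw [div_mul_cancel₀ _ hm0.ne']; exact min_le_left _ _
        nlinarith)
    rw [integral_const_mul, integral_neg, integral_const_mul,
      integral_sub (integrable_const _) (integrable_of_mem_Icc h1 h3)] at this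
    simp only [integral_const, probReal_univ, smul_eq_mul, mul_one] at this
    have h8 : 1 - (∫ x, φ x ∂μ) - ∫ y, ψ y ∂ν ≤ 0 := by
      by_contra! hcon
      nlinarith
    have : 0 < δ / m := by positivity
    linarith)
  have hπp : IsProbabilityMeasure π := ⟨by
    rw [measure_univ_eq_of_mem_transportPlans hπ]; exact measure_univ⟩
  refine ⟨π, hπ, le_trans ?_ hδ⟩
  have hint : Integrable (fun z => min (c z : ℝ) m) π :=
    Integrable.of_mem_Icc 0 m (by fun_prop) (ae_of_all _ fun z => ⟨by positivity, min_le_right _ _⟩)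
  have hval : ∫ z, min (c z : ℝ) m ∂π ≤ δ := by
    simp only [g] at hle
    rw [integral_sub (integrable_const _) (hint.div_const m), integral_div] at hle
    simp only [integral_const, probReal_univ, smul_eq_mul, mul_one] at hle
    have : (∫ z, min (c z : ℝ) m ∂π) / m ≤ δ / m := by linarith
    exact (div_le_div_iff_of_pos_right hm0).1 this
  calc ∫⁻ z, min (c z : ℝ≥0∞) n ∂π ≤ ∫⁻ z, ENNReal.ofReal (min (c z : ℝ) m) ∂π := by
        refine lintegral_mono fun z => ?_
        rw [ENNReal.ofReal_min, ENNReal.ofReal_coe_nnreal]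
        refine min_le_min le_rfl ?_
        rw [← ENNReal.ofReal_natCast]
        exact ENNReal.ofReal_le_ofReal (by rw [hm]; linarith)
    _ = ENNReal.ofReal (∫ z, min (c z : ℝ) m ∂π) :=
        (ofReal_integral_eq_lintegral_ofReal hint (ae_of_all _ fun z => by positivity)).symm
    _ ≤ ENNReal.ofReal δ := ENNReal.ofReal_le_ofReal hval

end BoundedDuality

end Bounded

/-! ### Couplings supported on a dense relation -/

lemma integrable_of_abs_le {Ω : Type*} [MeasurableSpace Ω] {m : Measure Ω} [IsFiniteMeasure m]
    {f : Ω → ℝ} (hf : Measurable f) (B : ℝ) (h : ∀ ω, |f ω| ≤ B) : Integrable f m :=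
  Integrable.of_bound hf.aestronglyMeasurable B (ae_of_all _ h)

lemma measurable_integral_right {Ω Ω' : Type*} [MeasurableSpace Ω] [MeasurableSpace Ω']
    {m : Measure Ω'} [SFinite m] {f : Ω → Ω' → ℝ} (hf : Measurable (Function.uncurry f)) :
    Measurable fun ω => ∫ ω', f ω ω' ∂m :=
  hf.stronglyMeasurable.integral_prod_right.measurable

section Dense

variable {X Y : Type*} [MeasurableSpace X] [MeasurableSpace Y]

lemma withDensity_mem_transportPlans {P : Measure X} {Q : Measure Y} [IsProbabilityMeasure P]
    [IsProbabilityMeasure Q] {D : X → Y → ℝ} (hD : Measurable (Function.uncurry D)) {B : ℝ}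
    (h0 : ∀ x y, 0 ≤ D x y) (hB : ∀ x y, D x y ≤ B) (h1 : ∀ x, ∫ y, D x y ∂Q = 1)
    (h2 : ∀ y, ∫ x, D x y ∂P = 1) :
    (P.prod Q).withDensity (fun z => ENNReal.ofReal (D z.1 z.2)) ∈ transportPlans P Q := by
  have hm : Measurable fun z : X × Y => ENNReal.ofReal (D z.1 z.2) := hD.ennreal_ofReal
  have habs : ∀ x y, |D x y| ≤ B := fun x y => by rw [abs_of_nonneg (h0 x y)]; exact hB x y
  constructor
  · ext A hA
    rw [Measure.map_apply measurable_fst hA, withDensity_apply _ (measurable_fst hA),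
      ← prod_univ, ← Measure.prod_restrict, lintegral_prod _ hm.aemeasurable, Measure.restrict_univ]
    have : ∀ x, ∫⁻ y, ENNReal.ofReal (D x y) ∂Q = 1 := fun x => by
      rw [← ofReal_integral_eq_lintegral_ofReal
        (integrable_of_abs_le (f := fun y => D x y) (hD.comp measurable_prodMk_left) B (habs x))
        (ae_of_all _ (h0 x)), h1,
        ENNReal.ofReal_one]
    simp [this]
  · ext A hA
    rw [Measure.map_apply measurable_snd hA, withDensity_apply _ (measurable_snd hA),
      ← univ_prod, ← Measure.prod_restrict, lintegral_prod_symm _ hm.aemeasurable,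
      Measure.restrict_univ]
    have : ∀ y, ∫⁻ x, ENNReal.ofReal (D x y) ∂P = 1 := fun y => by
      rw [← ofReal_integral_eq_lintegral_ofReal
        (integrable_of_abs_le (f := fun x => D x y) (hD.comp measurable_prodMk_right) B
          fun x => habs x y) (ae_of_all _ fun x => h0 x y), h2, ENNReal.ofReal_one]
    simp [this]

/-- A continuous marriage lemma: if `R` relates every `x` to most of `Y` and every `y` to most
of `X`, then some coupling is supported on `R`. The density `r(x, y) / q(x)`, with `r` the indicator
of `R` and `q(x) = Q(R_x)`, has the right first marginal, and a second marginal `h` close to `1`. An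
amount proportional to `h(y) - h(y')` is moved from `y` to `y'` along the points `x` that are
related to both, which corrects the second marginal, keeps the first, and leaves the density
nonnegative. -/
lemma exists_plan_of_dense_relation {P : Measure X} {Q : Measure Y} [IsProbabilityMeasure P]
    [IsProbabilityMeasure Q] {R : Set (X × Y)} (hR : MeasurableSet R)
    (hx : ∀ x, 7 / 8 ≤ Q.real {y | (x, y) ∈ R}) (hy : ∀ y, 7 / 8 ≤ P.real {x | (x, y) ∈ R}) :
    ∃ π ∈ transportPlans P Q, π Rᶜ = 0 := by
  let r : X → Y → ℝ := fun x y => R.indicator 1 (x, y)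
  have hr : Measurable (Function.uncurry r) := measurable_one.indicator hR
  have hr' : Measurable fun z : X × Y => r z.1 z.2 := hr
  have hr0 : ∀ x y, 0 ≤ r x y := fun x y => indicator_nonneg (fun _ _ => zero_le_one) _
  have hr1 : ∀ x y, r x y ≤ 1 := fun x y => indicator_le_self' (fun _ _ => zero_le_one) _
  have hrabs : ∀ x y, |r x y| ≤ 1 := fun x y => by rw [abs_of_nonneg (hr0 x y)]; exact hr1 x y
  have hrmX : ∀ y, Measurable fun x => r x y := fun y => hr.comp measurable_prodMk_right
  have hrmY : ∀ x, Measurable fun y => r x y := fun x => hr.comp measurable_prodMk_left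
  have hrX : ∀ y, ∫ x, r x y ∂P = P.real {x | (x, y) ∈ R} := fun y =>
    integral_indicator_one (measurable_prodMk_right hR)
  have hrY : ∀ x, ∫ y, r x y ∂Q = Q.real {y | (x, y) ∈ R} := fun x =>
    integral_indicator_one (measurable_prodMk_left hR)
  -- the degree `q`
  let q : X → ℝ := fun x => ∫ y, r x y ∂Q
  have hq : Measurable q := measurable_integral_right hr
  have hq78 : ∀ x, 7 / 8 ≤ q x := fun x => by simp only [q]; rw [hrY]; exact hx x
  have hq1 : ∀ x, q x ≤ 1 := fun x => by simp only [q]; rw [hrY]; exact measureReal_le_one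
  have hqpos : ∀ x, 0 < q x := fun x => lt_of_lt_of_le (by norm_num) (hq78 x)
  have hqi : ∀ x, 1 ≤ (q x)⁻¹ := fun x => (one_le_inv₀ (hqpos x)).2 (hq1 x)
  have hqi' : ∀ x, (q x)⁻¹ ≤ 8 / 7 := fun x => by
    rw [inv_le_comm₀ (hqpos x) (by norm_num)]; linarith [hq78 x]
  -- the second marginal `h` before the correction
  have hrq : Measurable fun z : X × Y => r z.1 z.2 * (q z.1)⁻¹ :=
    hr'.mul (hq.comp measurable_fst).inv
  have hrq0 : ∀ x y, 0 ≤ r x y * (q x)⁻¹ := fun x y =>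
    mul_nonneg (hr0 x y) (inv_nonneg.2 (hqpos x).le)
  have hrq87 : ∀ x y, r x y * (q x)⁻¹ ≤ 8 / 7 := fun x y => by
    calc r x y * (q x)⁻¹ ≤ 1 * (8 / 7) :=
          mul_le_mul (hr1 x y) (hqi' x) (inv_nonneg.2 (hqpos x).le) zero_le_one
      _ = 8 / 7 := one_mul _
  have hrqabs : ∀ x y, |r x y * (q x)⁻¹| ≤ 8 / 7 := fun x y => by
    rw [abs_of_nonneg (hrq0 x y)]; exact hrq87 x y
  have hrqX : ∀ y, Integrable (fun x => r x y * (q x)⁻¹) P := fun y =>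
    integrable_of_abs_le (hrq.comp measurable_prodMk_right) _ fun x => hrqabs x y
  have hrqY : ∀ x, Integrable (fun y => r x y * (q x)⁻¹) Q := fun x =>
    integrable_of_abs_le (hrq.comp measurable_prodMk_left) _ fun y => hrqabs x y
  let h : Y → ℝ := fun y => ∫ x, r x y * (q x)⁻¹ ∂P
  have hh : Measurable h := measurable_integral_right (hrq.comp measurable_swap)
  have hh78 : ∀ y, 7 / 8 ≤ h y := fun y => by
    refine (hy y).trans ((hrX y).symm.le.trans ?_)
    refine integral_mono (integrable_of_abs_le (hrmX y) 1 fun x => hrabs x y) (hrqX y) fun x => ?_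
    exact le_mul_of_one_le_right (hr0 x y) (hqi x)
  have hh87 : ∀ y, h y ≤ 8 / 7 := fun y => by
    refine (integral_mono (hrqX y) (integrable_const (8 / 7 : ℝ)) fun x => hrq87 x y).trans ?_
    simp
  have hhdiff : ∀ y y', |h y' - h y| ≤ 15 / 56 := fun y y' => by
    rw [abs_le]
    constructor <;> linarith [hh78 y, hh78 y', hh87 y, hh87 y']
  have hhint : Integrable h Q := integrable_of_abs_le hh (8 / 7) fun y => by
    rw [abs_of_nonneg (by linarith [hh78 y])]; exact hh87 y
  have hhmean : ∫ y, h y ∂Q = 1 := by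
    simp only [h]
    rw [integral_integral_swap (integrable_of_abs_le
      (f := Function.uncurry fun y x => r x y * (q x)⁻¹)
      (hrq.comp measurable_swap) (8 / 7) fun z => hrqabs z.2 z.1)]
    have : ∀ x, ∫ y, r x y * (q x)⁻¹ ∂Q = 1 := fun x => by
      rw [integral_mul_const]; exact mul_inv_cancel₀ (hqpos x).ne'
    simp [this]
  -- the measure `s` of the common neighbors of two points of `Y`
  let s : Y → Y → ℝ := fun y y' => ∫ x, r x y * r x y' ∂P
  have hs : Measurable fun z : Y × Y => s z.1 z.2 := by
    refine measurable_integral_right (f := fun (z : Y × Y) x => r x z.1 * r x z.2) ?_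
    exact (hr'.comp (by fun_prop : Measurable fun z : (Y × Y) × X => (z.2, z.1.1))).mul
      (hr'.comp (by fun_prop : Measurable fun z : (Y × Y) × X => (z.2, z.1.2)))
  have hrrm : ∀ y y', Measurable fun x => r x y * r x y' := fun y y' => (hrmX y).mul (hrmX y')
  have hrrabs : ∀ x y y', |r x y * r x y'| ≤ 1 := fun x y y' => by
    rw [abs_mul]
    exact mul_le_one₀ (hrabs x y) (abs_nonneg _) (hrabs x y')
  have hs34 : ∀ y y', 3 / 4 ≤ s y y' := fun y y' => by
    have i1 : Integrable (fun x => r x y) P := integrable_of_abs_le (hrmX y) 1 fun x => hrabs x y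
    have i2 : Integrable (fun x => r x y') P := integrable_of_abs_le (hrmX y') 1 fun x => hrabs x y'
    have i12 : Integrable (fun x => r x y + r x y') P := i1.add i2
    have h1 : ∫ x, (r x y + r x y' - 1) ∂P ≤ s y y' :=
      integral_mono (i12.sub (integrable_const 1))
        (integrable_of_abs_le (hrrm y y') 1 fun x => hrrabs x y y') fun x => by
          nlinarith [mul_nonneg (sub_nonneg.2 (hr1 x y)) (sub_nonneg.2 (hr1 x y'))]
    rw [integral_sub i12 (integrable_const 1), integral_add i1 i2, hrX, hrX] at h1
    simp only [integral_const, probReal_univ, smul_eq_mul, mul_one] at h1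
    linarith [hy y, hy y']
  have hspos : ∀ y y', 0 < s y y' := fun y y' => lt_of_lt_of_le (by norm_num) (hs34 y y')
  have hssymm : ∀ y y', s y y' = s y' y := fun y y' => by simp only [s, mul_comm]
  -- the correction kernel
  let k : Y → Y → ℝ := fun y y' => (h y' - h y) / s y y'
  have hk : Measurable fun z : Y × Y => k z.1 z.2 :=
    ((hh.comp measurable_snd).sub (hh.comp measurable_fst)).div hs
  have hkabs : ∀ y y', |k y y'| ≤ 5 / 14 := fun y y' => by
    simp only [k]
    rw [abs_div, abs_of_pos (hspos y y'), div_le_iff₀ (hspos y y')]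
    linarith [hs34 y y', hhdiff y y']
  have hkanti : ∀ y y', k y' y = - k y y' := fun y y' => by
    simp only [k]
    rw [hssymm y' y, ← neg_sub, neg_div]
  have hrk : Measurable fun z : (X × Y) × Y => r z.1.1 z.2 * k z.1.2 z.2 :=
    (hr'.comp (by fun_prop : Measurable fun z : (X × Y) × Y => (z.1.1, z.2))).mul
      (hk.comp (by fun_prop : Measurable fun z : (X × Y) × Y => (z.1.2, z.2)))
  have hrkabs : ∀ x y y', |r x y' * k y y'| ≤ 5 / 14 := fun x y y' => by
    rw [abs_mul]
    calc |r x y'| * |k y y'| ≤ 1 * (5 / 14) :=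
          mul_le_mul (hrabs x y') (hkabs y y') (abs_nonneg _) zero_le_one
      _ = 5 / 14 := one_mul _
  let w : X → Y → ℝ := fun x y => ∫ y', r x y' * k y y' ∂Q
  have hw : Measurable fun z : X × Y => w z.1 z.2 :=
    measurable_integral_right (f := fun (z : X × Y) y' => r z.1 y' * k z.2 y') hrk
  have hwabs : ∀ x y, |w x y| ≤ 5 / 14 := fun x y => by
    have := norm_integral_le_of_norm_le_const (μ := Q) (f := fun y' => r x y' * k y y')
      (ae_of_all _ fun y' => hrkabs x y y')
    simpa using this
  let D : X → Y → ℝ := fun x y => r x y * ((q x)⁻¹ + w x y)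
  have hD : Measurable (Function.uncurry D) :=
    hr'.mul ((hq.comp measurable_fst).inv.add hw)
  have hrwm : Measurable fun z : X × Y => r z.1 z.2 * w z.1 z.2 := hr'.mul hw
  have hrwabs : ∀ x y, |r x y * w x y| ≤ 5 / 14 := fun x y => by
    rw [abs_mul]
    calc |r x y| * |w x y| ≤ 1 * (5 / 14) :=
          mul_le_mul (hrabs x y) (hwabs x y) (abs_nonneg _) zero_le_one
      _ = 5 / 14 := one_mul _
  refine ⟨_, withDensity_mem_transportPlans (P := P) (Q := Q) (D := D) (B := 8 / 7 + 5 / 14) hD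
    (fun x y => mul_nonneg (hr0 x y) ?_) (fun x y => ?_) (fun x => ?_) (fun y => ?_), ?_⟩
  · linarith [hqi x, (abs_le.1 (hwabs x y)).1]
  · simp only [D, mul_add]
    linarith [hrq87 x y, (abs_le.1 (hrwabs x y)).2]
  · -- the correction does not change the first marginal, by antisymmetry of `k`
    simp only [D, mul_add]
    rw [integral_add (hrqY x) (integrable_of_abs_le (f := fun y => r x y * w x y)
      (hrwm.comp measurable_prodMk_left) _ (hrwabs x)),
      integral_mul_const, mul_inv_cancel₀ (hqpos x).ne']
    have hF : ∀ y, r x y * w x y = ∫ y', r x y * (r x y' * k y y') ∂Q := fun y =>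
      (integral_const_mul _ _).symm
    have hFint : Integrable (Function.uncurry fun y y' => r x y * (r x y' * k y y'))
        (Q.prod Q) := by
      refine integrable_of_abs_le (((hrmY x).comp measurable_fst).mul
        (((hrmY x).comp measurable_snd).mul hk)) (1 * (5 / 14)) fun z => ?_
      simp only [Function.uncurry]
      rw [abs_mul]
      exact mul_le_mul (hrabs _ _) (hrkabs _ _ _) (abs_nonneg _) zero_le_one
    have hanti : ∫ y, ∫ y', r x y * (r x y' * k y y') ∂Q ∂Q
        = - ∫ y, ∫ y', r x y * (r x y' * k y y') ∂Q ∂Q := by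
      conv_lhs => rw [integral_integral_swap hFint]
      rw [← integral_neg]
      refine integral_congr_ae (ae_of_all _ fun y => ?_)
      simp only
      rw [← integral_neg]
      refine integral_congr_ae (ae_of_all _ fun y' => ?_)
      simp only
      rw [hkanti y y']
      ring
    simp only [hF]
    linarith
  · -- the correction changes the second marginal from `h` to its mean `1`
    simp only [D, mul_add]
    rw [integral_add (hrqX y) (integrable_of_abs_le (f := fun x => r x y * w x y)
      (hrwm.comp measurable_prodMk_right) _ fun x => hrwabs x y)]
    have hF : ∀ x, r x y * w x y = ∫ y', r x y * (r x y' * k y y') ∂Q := fun x =>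
      (integral_const_mul _ _).symm
    have hFint : Integrable (Function.uncurry fun x y' => r x y * (r x y' * k y y'))
        (P.prod Q) := by
      refine integrable_of_abs_le (((hrmX y).comp measurable_fst).mul
        (hr'.mul ((hk.comp measurable_prodMk_left).comp measurable_snd))) (1 * (5 / 14)) fun z => ?_
      simp only [Function.uncurry]
      rw [abs_mul]
      exact mul_le_mul (hrabs _ _) (hrkabs _ _ _) (abs_nonneg _) zero_le_one
    have hinner : ∀ y', ∫ x, r x y * (r x y' * k y y') ∂P = h y' - h y := fun y' => by
      simp only [← mul_assoc]
      rw [integral_mul_const]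
      exact mul_div_cancel₀ _ (hspos y y').ne'
    simp only [hF]
    rw [integral_integral_swap hFint]
    simp only [hinner]
    rw [integral_sub hhint (integrable_const _), hhmean]
    simp only [integral_const, probReal_univ, smul_eq_mul, one_mul]
    change h y + (1 - h y) = 1
    ring
  · rw [withDensity_apply _ hR.compl]
    refine (setLIntegral_congr_fun (g := fun _ => 0) hR.compl fun z hz => ?_).trans (by simp)
    have : r z.1 z.2 = 0 := indicator_of_notMem hz _
    simp [D, this]

end Dense

/-! ### Gluing plans along blocks -/

section Trim

variable {Ω A : Type*} [MeasurableSpace Ω] [MeasurableSpace A]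

/-- If `m ≤ ρ` then `m` has a density with values in `[0, 1]` with respect to `ρ`. -/
lemma exists_density_of_le {m ρ : Measure Ω} [SigmaFinite ρ] [IsFiniteMeasure m] (h : m ≤ ρ) :
    ∃ F : Ω → ℝ, Measurable F ∧ (∀ ω, F ω ∈ Icc (0 : ℝ) 1) ∧
      m = ρ.withDensity fun ω => ENNReal.ofReal (F ω) := by
  refine ⟨fun ω => (min (m.rnDeriv ρ ω) 1).toReal,
    ((Measure.measurable_rnDeriv m ρ).min measurable_const).ennreal_toReal,
    fun ω => ⟨ENNReal.toReal_nonneg, ENNReal.toReal_le_of_le_ofReal zero_le_one (by simp)⟩, ?_⟩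
  conv_lhs => rw [← Measure.withDensity_rnDeriv_eq m ρ (Measure.absolutelyContinuous_of_le h)]
  refine withDensity_congr_ae ?_
  filter_upwards [Measure.rnDeriv_le_one_of_le h] with ω hω
  rw [ENNReal.ofReal_toReal (ne_top_of_le_ne_top ENNReal.one_ne_top (min_le_right _ _)),
    min_eq_left (show _ ≤ (1 : ℝ≥0∞) from hω)]

/-- Trimming: a measure whose image exceeds `α` by at most `δ` contains a measure whose image is
dominated by `α`, and which misses at most the mass of `δ`. -/
lemma exists_le_map_le {τ : Measure Ω} {p : Ω → A} (hp : Measurable p) {α δ : Measure A}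
    [IsFiniteMeasure α] [IsFiniteMeasure δ] (h : τ.map p ≤ α + δ) :
    ∃ τ' ≤ τ, τ'.map p ≤ α ∧ τ univ ≤ τ' univ + δ univ := by
  obtain ⟨F, hF, hF01, hα⟩ := exists_density_of_le (m := α) (ρ := α + δ)
    (Measure.le_add_right le_rfl)
  let f : A → ℝ≥0∞ := fun x => ENNReal.ofReal (F x)
  have hf : Measurable f := hF.ennreal_ofReal
  have hf1 : ∀ x, f x ≤ 1 := fun x => by
    rw [← ENNReal.ofReal_one]; exact ENNReal.ofReal_le_ofReal (hF01 x).2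
  refine ⟨τ.withDensity (f ∘ p), ?_, ?_, ?_⟩
  · calc τ.withDensity (f ∘ p) ≤ τ.withDensity 1 :=
          withDensity_mono (ae_of_all _ fun ω => hf1 (p ω))
      _ = τ := withDensity_one
  · refine Measure.le_iff.2 fun s hs => ?_
    rw [Measure.map_apply hp hs, withDensity_apply _ (hp hs)]
    calc ∫⁻ ω in p ⁻¹' s, (f ∘ p) ω ∂τ = ∫⁻ x in s, f x ∂(τ.map p) :=
          (setLIntegral_map hs hf hp).symm
      _ ≤ ∫⁻ x in s, f x ∂(α + δ) := lintegral_mono' (Measure.restrict_mono le_rfl h) le_rfl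
      _ = α s := by rw [← withDensity_apply _ hs, ← hα]
  · have h1 : ∀ m : Measure A, m univ = ∫⁻ x, f x ∂m + ∫⁻ x, (1 - f x) ∂m := by
      intro m
      rw [← lintegral_add_left hf, ← lintegral_one]
      exact lintegral_congr fun x => (add_tsub_cancel_of_le (hf1 x)).symm
    have hfα : ∫⁻ x, f x ∂(α + δ) = α univ := by
      rw [← setLIntegral_univ, ← withDensity_apply _ .univ, ← hα]
    have h2 : ∫⁻ x, (1 - f x) ∂(α + δ) = δ univ := by
      have := h1 (α + δ)
      rw [hfα, Measure.add_apply] at this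
      exact ((ENNReal.add_right_inj (measure_ne_top α univ)).1 this).symm
    have h3 : τ univ = (τ.map p) univ := by rw [Measure.map_apply hp .univ, preimage_univ]
    rw [h3, h1, withDensity_apply _ .univ, setLIntegral_univ, lintegral_map hf hp]
    refine add_le_add le_rfl ?_
    rw [← h2]
    exact lintegral_mono' h le_rfl

/-- The restrictions of `m` and `m'` to `S` differ by at most `ε` in total variation. -/
def CloseOn (m m' : Measure Ω) (S : Set Ω) (ε : ℝ≥0∞) : Prop :=
  ∃ δ : Measure Ω, δ univ ≤ ε ∧ m.restrict S ≤ m'.restrict S + δ ∧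
    m'.restrict S ≤ m.restrict S + δ

lemma CloseOn.symm {m m' : Measure Ω} {S : Set Ω} {ε : ℝ≥0∞} (h : CloseOn m m' S ε) :
    CloseOn m' m S ε := by
  obtain ⟨δ, h1, h2, h3⟩ := h
  exact ⟨δ, h1, h3, h2⟩

lemma CloseOn.mono {m m' : Measure Ω} {S T : Set Ω} {ε : ℝ≥0∞} (h : CloseOn m m' S ε)
    (hTS : T ⊆ S) : CloseOn m m' T ε := by
  obtain ⟨δ, h1, h2, h3⟩ := h
  have key : ∀ n n' : Measure Ω, n.restrict S ≤ n'.restrict S + δ →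
      n.restrict T ≤ n'.restrict T + δ := by
    intro n n' hn
    have := Measure.restrict_mono (le_refl T) hn
    rw [Measure.restrict_add, Measure.restrict_restrict_of_subset hTS,
      Measure.restrict_restrict_of_subset hTS] at this
    exact this.trans (add_le_add le_rfl Measure.restrict_le_self)
  exact ⟨δ, h1, key _ _ h2, key _ _ h3⟩

lemma CloseOn.measure_le {m m' : Measure Ω} {S T : Set Ω} {ε : ℝ≥0∞} (h : CloseOn m m' S ε)
    (hTS : T ⊆ S) : m T ≤ m' T + ε := by
  obtain ⟨δ, h1, h2, -⟩ := h.mono hTS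
  have := h2 T
  rw [Measure.restrict_apply_self, Measure.add_apply, Measure.restrict_apply_self] at this
  exact this.trans (add_le_add le_rfl ((measure_mono (subset_univ _)).trans h1))

/-- Almost everywhere convergence of densities with values in `[0, 1]` implies convergence in total
variation on sets of finite reference measure. -/
lemma eventually_closeOn {ρ : Measure Ω} [SFinite ρ] {F : ℕ → Ω → ℝ} (hF : ∀ n, Measurable (F n))
    (h01 : ∀ n ω, F n ω ∈ Icc (0 : ℝ) 1)
    (hlim : ∀ᵐ ω ∂ρ, ∃ l, Tendsto (fun n => F n ω) atTop (𝓝 l)) {S : Set Ω}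
    (hS : ρ S ≠ ∞) {ε : ℝ≥0∞} (hε : ε ≠ 0) :
    ∀ᶠ n in atTop, CloseOn (ρ.withDensity fun ω => ENNReal.ofReal (F n ω))
      (ρ.withDensity fun ω => ENNReal.ofReal (limsup (fun n => F n ω) atTop)) S ε := by
  set L : Ω → ℝ := fun ω => limsup (fun n => F n ω) atTop with hL
  have hLm : Measurable L := .limsup hF
  have hL01 : ∀ ω, L ω ∈ Icc (0 : ℝ) 1 := fun ω => limsup_mem_Icc fun n => h01 n ω
  have hdom : Tendsto (fun n => ∫⁻ ω in S, ENNReal.ofReal |F n ω - L ω| ∂ρ) atTop (𝓝 0) := by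
    have := tendsto_lintegral_of_dominated_convergence (μ := ρ.restrict S)
      (F := fun n ω => ENNReal.ofReal |F n ω - L ω|) (f := fun _ => 0) (fun _ => 1)
      (fun n => ((hF n).sub hLm).abs.ennreal_ofReal)
      (fun n => ae_of_all _ fun ω => by
        rw [← ENNReal.ofReal_one]
        refine ENNReal.ofReal_le_ofReal (abs_le.2 ⟨?_, ?_⟩) <;>
          linarith [(h01 n ω).1, (h01 n ω).2, (hL01 ω).1, (hL01 ω).2])
      (by simpa using hS)
      (by
        filter_upwards [ae_restrict_of_ae hlim] with ω ⟨l, hl⟩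
        have hLl : L ω = l := hl.limsup_eq
        have h0 : Tendsto (fun n => |F n ω - L ω|) atTop (𝓝 0) := by
          rw [hLl]
          simpa using (hl.sub_const l).abs
        simpa using ENNReal.tendsto_ofReal h0)
    simpa using this
  filter_upwards [hdom.eventually (ge_mem_nhds (pos_iff_ne_zero.2 hε))] with n hn
  refine ⟨(ρ.restrict S).withDensity fun ω => ENNReal.ofReal |F n ω - L ω|, ?_, ?_, ?_⟩
  · rwa [withDensity_apply _ .univ, Measure.restrict_univ]
  · rw [restrict_withDensity' , restrict_withDensity', ← withDensity_add_left hLm.ennreal_ofReal]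
    refine withDensity_mono (ae_of_all _ fun ω => ?_)
    simp only [Pi.add_apply]
    rw [← ENNReal.ofReal_add (hL01 ω).1 (abs_nonneg _)]
    exact ENNReal.ofReal_le_ofReal (by linarith [le_abs_self (F n ω - L ω)])
  · rw [restrict_withDensity', restrict_withDensity', ← withDensity_add_left (hF n).ennreal_ofReal]
    refine withDensity_mono (ae_of_all _ fun ω => ?_)
    simp only [Pi.add_apply]
    rw [← ENNReal.ofReal_add (h01 n ω).1 (abs_nonneg _)]
    exact ENNReal.ofReal_le_ofReal (by linarith [neg_abs_le (F n ω - L ω)])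

lemma measure_eq_tsum_label (m : Measure Ω) {l : Ω → ℕ} (hl : Measurable l) {s : Set Ω}
    (hs : MeasurableSet s) : m s = ∑' j, m (s ∩ l ⁻¹' {j}) := by
  have h : s = ⋃ j, s ∩ l ⁻¹' {j} := by
    ext ω; simp
  conv_lhs => rw [h]
  refine measure_iUnion ?_ fun j => hs.inter (hl (measurableSet_singleton j))
  intro i j hij
  refine Set.disjoint_left.2 fun ω hω hω' => hij ?_
  exact hω.2.symm.trans hω'.2

/-- If measures with a fixed image `μ` and a fixed distribution of labels converge in total
variation on each level of the label, then the limit has the image `μ`: no mass escapes, since the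
mass of each level is fixed. -/
lemma map_eq_of_eventually_closeOn {e : Ω → A} (he : Measurable e) {l : Ω → ℕ} (hl : Measurable l)
    {μ : Measure A} [IsFiniteMeasure μ] {lam : Measure ℕ} {m : ℕ → Measure Ω} {m' : Measure Ω}
    (h1 : ∀ n, (m n).map e = μ) (h2 : ∀ n, (m n).map l = lam)
    (h : ∀ j, ∀ ε : ℝ≥0∞, ε ≠ 0 → ∀ᶠ n in atTop, CloseOn (m n) m' (l ⁻¹' {j}) ε) :
    m'.map e = μ := by
  have hlj : ∀ j, MeasurableSet (l ⁻¹' {j}) := fun j => hl (measurableSet_singleton j)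
  have hle : m'.map e ≤ μ := by
    refine Measure.le_iff.2 fun s hs => ?_
    rw [Measure.map_apply he hs, measure_eq_tsum_label m' hl (he hs), ENNReal.tsum_eq_iSup_sum]
    refine iSup_le fun J => ENNReal.le_of_forall_pos_le_add fun ε hε _ => ?_
    obtain ⟨ε', hε'0, hε'⟩ := ENNReal.exists_pos_sum_of_countable (ι := ℕ) (ε := (ε : ℝ≥0∞))
      (by exact_mod_cast hε.ne')
    have hall : ∀ᶠ n in atTop, ∀ j ∈ J, CloseOn (m n) m' (l ⁻¹' {j}) (ε' j) :=
      (Filter.eventually_all_finset J).2 fun j _ => h j _ (by exact_mod_cast (hε'0 j).ne')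
    obtain ⟨n, hn⟩ := hall.exists
    calc ∑ j ∈ J, m' (e ⁻¹' s ∩ l ⁻¹' {j})
        ≤ ∑ j ∈ J, (m n (e ⁻¹' s ∩ l ⁻¹' {j}) + ε' j) := Finset.sum_le_sum fun j hj =>
          (hn j hj).symm.measure_le inter_subset_right
      _ = ∑ j ∈ J, m n (e ⁻¹' s ∩ l ⁻¹' {j}) + ∑ j ∈ J, (ε' j : ℝ≥0∞) := Finset.sum_add_distrib
      _ ≤ ∑' j, m n (e ⁻¹' s ∩ l ⁻¹' {j}) + ∑' j, (ε' j : ℝ≥0∞) :=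
          add_le_add (ENNReal.sum_le_tsum J) (ENNReal.sum_le_tsum J)
      _ ≤ μ s + ε := by
          refine add_le_add ?_ hε'.le
          rw [← measure_eq_tsum_label (m n) hl (he hs), ← Measure.map_apply he hs, h1]
  have hfin : IsFiniteMeasure (m'.map e) := isFiniteMeasure_of_le μ hle
  refine Measure.eq_of_le_of_measure_univ_eq hle (le_antisymm (hle univ) ?_)
  have hμl : μ univ = lam univ := by
    rw [← h1 0, ← h2 0, Measure.map_apply he .univ, Measure.map_apply hl .univ, preimage_univ,
      preimage_univ]
  rw [hμl, Measure.map_apply he .univ, preimage_univ,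
    measure_eq_tsum_label lam measurable_id .univ, measure_eq_tsum_label m' hl .univ]
  refine ENNReal.tsum_le_tsum fun j => ENNReal.le_of_forall_pos_le_add fun ε hε _ => ?_
  obtain ⟨n, hn⟩ := (h j ε (by exact_mod_cast hε.ne')).exists
  have := hn.measure_le le_rfl
  rw [← Measure.map_apply hl (measurableSet_singleton j), h2] at this
  simpa using this

end Trim

section Glue

variable {X Y : Type*} [MeasurableSpace X] [MeasurableSpace Y]

lemma le_prod_count {μ : Measure X} [SFinite μ] {m : Measure (X × ℕ)}
    (h : m.map Prod.fst ≤ μ) : m ≤ μ.prod Measure.count := by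
  refine Measure.le_iff.2 fun s hs => ?_
  rw [measure_eq_tsum_label m measurable_snd hs, Measure.prod_apply_symm hs, lintegral_count]
  refine ENNReal.tsum_le_tsum fun j => ?_
  have hsj : MeasurableSet ((fun x => (x, j)) ⁻¹' s) := measurable_prodMk_right hs
  refine le_trans (measure_mono ?_) ((Measure.map_apply measurable_fst hsj).symm.le.trans (h _))
  rintro ⟨x, i⟩ ⟨hxi, rfl⟩
  exact hxi

/-- Densities of convex combinations are convex combinations of densities. -/
lemma map_smul_add_smul_eq_withDensity {Ω' Ω : Type*} [MeasurableSpace Ω'] [MeasurableSpace Ω]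
    {e : Ω' → Ω} (he : Measurable e) {ρ : Measure Ω} {π π' : Measure Ω'} {F F' : Ω → ℝ}
    (hF : Measurable F) (hF' : Measurable F') (h0 : ∀ ω, 0 ≤ F ω) (h0' : ∀ ω, 0 ≤ F' ω)
    (h : π.map e = ρ.withDensity fun ω => ENNReal.ofReal (F ω))
    (h' : π'.map e = ρ.withDensity fun ω => ENNReal.ofReal (F' ω)) (s t : ℝ≥0) :
    (s • π + t • π').map e =
      ρ.withDensity fun ω => ENNReal.ofReal ((s : ℝ) * F ω + (t : ℝ) * F' ω) := by
  rw [Measure.map_add _ _ he, Measure.map_smul, Measure.map_smul, h, h']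
  have e1 : (s • ρ.withDensity fun ω => ENNReal.ofReal (F ω))
      = ρ.withDensity fun ω => (s : ℝ≥0∞) * ENNReal.ofReal (F ω) :=
    (withDensity_smul (s : ℝ≥0∞) hF.ennreal_ofReal).symm
  have e2 : (t • ρ.withDensity fun ω => ENNReal.ofReal (F' ω))
      = ρ.withDensity fun ω => (t : ℝ≥0∞) * ENNReal.ofReal (F' ω) :=
    (withDensity_smul (t : ℝ≥0∞) hF'.ennreal_ofReal).symm
  rw [e1, e2, ← withDensity_add_left (by fun_prop)]
  congr 1
  ext ω
  rw [Pi.add_apply, ENNReal.ofReal_add (mul_nonneg s.coe_nonneg (h0 ω))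
    (mul_nonneg t.coe_nonneg (h0' ω)), ENNReal.ofReal_mul s.coe_nonneg,
    ENNReal.ofReal_mul t.coe_nonneg, ENNReal.ofReal_coe_nnreal, ENNReal.ofReal_coe_nnreal]

/-- From decreasing convex sets of transport plans, select plans `π n` such that the joint
distributions of the point `x` with the label `b(y)`, and of the point `y` with the label `a(x)`,
converge in total variation on each level of the label. -/
lemma exists_closeOn_of_antitone_convex {μ : Measure X} {ν : Measure Y} [IsProbabilityMeasure μ]
    [IsProbabilityMeasure ν] {a : X → ℕ} (ha : Measurable a) {b : Y → ℕ} (hb : Measurable b)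
    (G : ℕ → Set (Measure (X × Y))) (hanti : Antitone G) (hne : ∀ n, (G n).Nonempty)
    (hG : ∀ n, G n ⊆ transportPlans μ ν)
    (hconv : ∀ n, ∀ π ∈ G n, ∀ π' ∈ G n, ∀ s t : ℝ≥0, s + t = 1 → s • π + t • π' ∈ G n) :
    ∃ π : ℕ → Measure (X × Y), (∀ n, π n ∈ G n) ∧
      ∃ α : Measure (X × ℕ), ∃ β : Measure (Y × ℕ), α.map Prod.fst = μ ∧ β.map Prod.fst = ν ∧
        (∀ j, ∀ ε : ℝ≥0∞, ε ≠ 0 → ∀ᶠ n in atTop,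
          CloseOn ((π n).map fun z => (z.1, b z.2)) α (Prod.snd ⁻¹' {j}) ε) ∧
        (∀ k, ∀ ε : ℝ≥0∞, ε ≠ 0 → ∀ᶠ n in atTop,
          CloseOn ((π n).map fun z => (z.2, a z.1)) β (Prod.snd ⁻¹' {k}) ε) := by
  let p : X × Y → X × ℕ := fun z => (z.1, b z.2)
  let q : X × Y → Y × ℕ := fun z => (z.2, a z.1)
  have hp : Measurable p := by fun_prop
  have hq : Measurable q := by fun_prop
  -- the joint distributions have densities in `[0, 1]` with respect to the σ-finite `ρ₁`, `ρ₂`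
  let ρ₁ : Measure (X × ℕ) := μ.prod Measure.count
  let ρ₂ : Measure (Y × ℕ) := ν.prod Measure.count
  let C : ℕ → Set ((X × ℕ → ℝ) × (Y × ℕ → ℝ)) := fun n => {F | (Measurable F.1 ∧ Measurable F.2) ∧
    ((∀ ω, F.1 ω ∈ Icc (0 : ℝ) 1) ∧ ∀ ω, F.2 ω ∈ Icc (0 : ℝ) 1) ∧ ∃ π ∈ G n,
      π.map p = ρ₁.withDensity (fun ω => ENNReal.ofReal (F.1 ω)) ∧
      π.map q = ρ₂.withDensity (fun ω => ENNReal.ofReal (F.2 ω))}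
  obtain ⟨F, hF, hl1, hl2⟩ := exists_ae_tendsto_pair ρ₁ ρ₂ C
    (by
      rintro i j hij F ⟨h1, h2, π, hπ, h3⟩
      exact ⟨h1, h2, π, hanti hij hπ, h3⟩)
    (by
      rintro n F ⟨h1, h2, π, hπ, h3, h4⟩ F' ⟨h1', h2', π', hπ', h3', h4'⟩ s t hs ht hst
      lift s to ℝ≥0 using hs
      lift t to ℝ≥0 using ht
      refine ⟨⟨(h1.1.const_smul (s : ℝ)).add (h1'.1.const_smul (t : ℝ)),
        (h1.2.const_smul (s : ℝ)).add (h1'.2.const_smul (t : ℝ))⟩,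
        ⟨fun ω => convex_Icc (0 : ℝ) 1 (h2.1 ω) (h2'.1 ω) s.2 t.2 hst,
          fun ω => convex_Icc (0 : ℝ) 1 (h2.2 ω) (h2'.2 ω) s.2 t.2 hst⟩,
        s • π + t • π',
        hconv n π hπ π' hπ' _ _ (NNReal.eq hst), ?_, ?_⟩
      · exact map_smul_add_smul_eq_withDensity hp h1.1 h1'.1 (fun ω => (h2.1 ω).1)
          (fun ω => (h2'.1 ω).1) h3 h3' s t
      · exact map_smul_add_smul_eq_withDensity hq h1.2 h1'.2 (fun ω => (h2.2 ω).1)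
          (fun ω => (h2'.2 ω).1) h4 h4' s t)
    (fun n => by
      obtain ⟨π, hπ⟩ := hne n
      have hfin : IsFiniteMeasure π := ⟨by
        rw [measure_univ_eq_of_mem_transportPlans (hG n hπ)]; exact measure_lt_top _ _⟩
      obtain ⟨F₁, h1, h2, h3⟩ := exists_density_of_le (m := π.map p) (ρ := ρ₁)
        (le_prod_count (by rw [Measure.map_map measurable_fst hp]; exact (hG n hπ).1.le))
      obtain ⟨F₂, k1, k2, k3⟩ := exists_density_of_le (m := π.map q) (ρ := ρ₂)
        (le_prod_count (by rw [Measure.map_map measurable_fst hq]; exact (hG n hπ).2.le))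
      exact ⟨(F₁, F₂), ⟨h1, k1⟩, ⟨h2, k2⟩, π, hπ, h3, k3⟩)
    (fun n F hF => hF.1) (fun n F hF => hF.2.1)
  choose hFm hF01 π hπ hπp hπq using hF
  have hclose₁ : ∀ j, ∀ ε : ℝ≥0∞, ε ≠ 0 → ∀ᶠ n in atTop, CloseOn ((π n).map p)
      (ρ₁.withDensity fun ω => ENNReal.ofReal (limsup (fun n => (F n).1 ω) atTop))
      (Prod.snd ⁻¹' {j}) ε := by
    intro j ε hε
    simp only [hπp]
    refine eventually_closeOn (fun n => (hFm n).1) (fun n => (hF01 n).1) hl1 ?_ hε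
    rw [← univ_prod, Measure.prod_prod, measure_univ, Measure.count_singleton, mul_one]
    exact ENNReal.one_ne_top
  have hclose₂ : ∀ k, ∀ ε : ℝ≥0∞, ε ≠ 0 → ∀ᶠ n in atTop, CloseOn ((π n).map q)
      (ρ₂.withDensity fun ω => ENNReal.ofReal (limsup (fun n => (F n).2 ω) atTop))
      (Prod.snd ⁻¹' {k}) ε := by
    intro k ε hε
    simp only [hπq]
    refine eventually_closeOn (fun n => (hFm n).2) (fun n => (hF01 n).2) hl2 ?_ hε
    rw [← univ_prod, Measure.prod_prod, measure_univ, Measure.count_singleton, mul_one]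
    exact ENNReal.one_ne_top
  refine ⟨π, hπ, _, _, ?_, ?_, hclose₁, hclose₂⟩
  · refine map_eq_of_eventually_closeOn measurable_fst measurable_snd (lam := ν.map b)
      (fun n => ?_) (fun n => ?_) hclose₁
    · rw [Measure.map_map measurable_fst hp]; exact (hG n (hπ n)).1
    · rw [Measure.map_map measurable_snd hp, ← (hG n (hπ n)).2, Measure.map_map hb measurable_snd]
      rfl
  · refine map_eq_of_eventually_closeOn measurable_fst measurable_snd (lam := μ.map a)
      (fun n => ?_) (fun n => ?_) hclose₂
    · rw [Measure.map_map measurable_fst hq]; exact (hG n (hπ n)).2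
    · rw [Measure.map_map measurable_snd hq, ← (hG n (hπ n)).1, Measure.map_map ha measurable_fst]
      rfl

/-- On one block of labels, a plan with small truncated cost, with its expensive part removed and
trimmed to the limit distributions, has small cost and misses little mass. -/
lemma exists_block_plan {c : X × Y → ℝ≥0} (hc : Measurable c) {a : X → ℕ} (ha : Measurable a)
    {b : Y → ℕ} (hb : Measurable b) {α : Measure (X × ℕ)} {β : Measure (Y × ℕ)}
    [IsFiniteMeasure α] [IsFiniteMeasure β] (k j : ℕ) {ε : ℝ≥0∞} (hε' : ε ≠ ∞) {n : ℕ} (hn : 1 ≤ n)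
    {π : Measure (X × Y)} (hπ : ∫⁻ z, min (c z : ℝ≥0∞) n ∂π ≤ ε)
    (h₁ : CloseOn (π.map fun z => (z.1, b z.2)) α (Prod.snd ⁻¹' {j}) ε)
    (h₂ : CloseOn (π.map fun z => (z.2, a z.1)) β (Prod.snd ⁻¹' {k}) ε) :
    ∃ τ : Measure (X × Y), τ {z | a z.1 = k ∧ b z.2 = j}ᶜ = 0 ∧
      τ.map (fun z => (z.1, b z.2)) ≤ α.restrict ((a ⁻¹' {k}) ×ˢ {j}) ∧
      τ.map (fun z => (z.2, a z.1)) ≤ β.restrict ((b ⁻¹' {j}) ×ˢ {k}) ∧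
      ∫⁻ z, c z ∂τ ≤ ε ∧ α ((a ⁻¹' {k}) ×ˢ {j}) ≤ τ univ + 4 * ε ∧
      β ((b ⁻¹' {j}) ×ˢ {k}) ≤ τ univ + 4 * ε := by
  set p : X × Y → X × ℕ := fun z => (z.1, b z.2)
  set q : X × Y → Y × ℕ := fun z => (z.2, a z.1)
  have hp : Measurable p := by fun_prop
  have hq : Measurable q := by fun_prop
  set S := (a ⁻¹' {k}) ×ˢ ({j} : Set ℕ)
  set T := (b ⁻¹' {j}) ×ˢ ({k} : Set ℕ)
  have hS : MeasurableSet S := (ha (measurableSet_singleton k)).prod (measurableSet_singleton j)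
  have hT : MeasurableSet T := (hb (measurableSet_singleton j)).prod (measurableSet_singleton k)
  set B : Set (X × Y) := {z | a z.1 = k ∧ b z.2 = j}
  have hpS : p ⁻¹' S = B := by ext z; simp [p, S, B]
  have hqT : q ⁻¹' T = B := by ext z; simp [q, T, B, and_comm]
  have hBm : MeasurableSet B := hpS ▸ hp hS
  have h₁S := h₁.mono (T := S) (fun z hz => hz.2)
  have h₂T := h₂.mono (T := T) (fun z hz => hz.2)
  obtain ⟨δ₁, hδ₁, hpδ, -⟩ := id h₁S
  obtain ⟨δ₂, hδ₂, hqδ, -⟩ := id h₂T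
  have fδ₁ : IsFiniteMeasure δ₁ := ⟨hδ₁.trans_lt (lt_top_iff_ne_top.2 hε')⟩
  have fδ₂ : IsFiniteMeasure δ₂ := ⟨hδ₂.trans_lt (lt_top_iff_ne_top.2 hε')⟩
  let L : Set (X × Y) := {z | (c z : ℝ≥0∞) < n}
  have hL : MeasurableSet L := measurableSet_lt (by fun_prop) measurable_const
  obtain ⟨τ₁, hτ₁, hτ₁p, hτ₁m⟩ := exists_le_map_le (τ := π.restrict (B ∩ L)) hp
    (α := α.restrict S) (δ := δ₁) (by
      refine le_trans ?_ hpδ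
      rw [Measure.restrict_map hp hS, hpS]
      exact Measure.map_mono (Measure.restrict_mono inter_subset_left le_rfl) hp)
  obtain ⟨τ₂, hτ₂, hτ₂q, hτ₂m⟩ := exists_le_map_le (τ := τ₁) hq
    (α := β.restrict T) (δ := δ₂) (by
      refine le_trans ?_ hqδ
      rw [Measure.restrict_map hq hT, hqT]
      exact Measure.map_mono (hτ₁.trans (Measure.restrict_mono inter_subset_left le_rfl)) hq)
  -- the removed part `{c ≥ n}` is small by Markov's inequality
  have hmarkov : π Lᶜ ≤ ε := by
    refine le_trans ?_ hπ
    rw [← setLIntegral_one]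
    calc ∫⁻ _ in Lᶜ, 1 ∂π ≤ ∫⁻ z in Lᶜ, min (c z : ℝ≥0∞) n ∂π := by
          refine setLIntegral_mono' hL.compl fun z hz => ?_
          have h1 : (1 : ℝ≥0∞) ≤ n := by exact_mod_cast hn
          exact le_min (h1.trans (not_lt.1 hz)) h1
      _ ≤ ∫⁻ z, min (c z : ℝ≥0∞) n ∂π := setLIntegral_le_lintegral _ _
  have hmass : π B + ε ≤ τ₂ univ + 4 * ε := by
    have h1 : π B ≤ π (B ∩ L) + π Lᶜ := by
      refine (measure_mono fun z hz => ?_).trans (measure_union_le _ _)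
      by_cases hzL : z ∈ L
      · exact Or.inl ⟨hz, hzL⟩
      · exact Or.inr hzL
    rw [Measure.restrict_apply_univ] at hτ₁m
    calc π B + ε ≤ ((τ₂ univ + ε) + ε + ε) + ε := by
          gcongr
          refine h1.trans (add_le_add (hτ₁m.trans (add_le_add ?_ hδ₁)) hmarkov)
          exact hτ₂m.trans (add_le_add le_rfl hδ₂)
      _ = τ₂ univ + 4 * ε := by ring
  refine ⟨τ₂, ?_, ?_, hτ₂q, ?_, ?_, ?_⟩
  · refine le_antisymm ?_ zero_le
    refine (hτ₂.trans hτ₁ _).trans ?_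
    rw [Measure.restrict_apply hBm.compl]
    refine (measure_mono (t := ∅) ?_).trans (by simp)
    exact fun z hz => hz.1 hz.2.1
  · exact (Measure.map_mono hτ₂ hp).trans hτ₁p
  · calc ∫⁻ z, c z ∂τ₂ ≤ ∫⁻ z in B ∩ L, c z ∂π := lintegral_mono' (hτ₂.trans hτ₁) le_rfl
      _ ≤ ∫⁻ z in B ∩ L, min (c z : ℝ≥0∞) n ∂π := by
          refine setLIntegral_mono' (hBm.inter hL) fun z hz => ?_
          exact le_min le_rfl hz.2.le
      _ ≤ ε := (setLIntegral_le_lintegral _ _).trans hπ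
  · refine (h₁.symm.measure_le (T := S) fun z hz => hz.2).trans ?_
    rwa [Measure.map_apply hp hS, hpS]
  · refine (h₂.symm.measure_le (T := T) fun z hz => hz.2).trans ?_
    rwa [Measure.map_apply hq hT, hqT]

end Glue

section Glue

variable {X Y : Type*} [MeasurableSpace X] [MeasurableSpace Y]

lemma lintegral_label {m : Measure X} {a : X → ℕ} (ha : Measurable a) (f : ℕ → ℝ≥0∞) :
    ∫⁻ x, f (a x) ∂m = ∑' k, f k * m (a ⁻¹' {k}) := by
  rw [← lintegral_map (f := f) (measurable_of_countable f) ha, lintegral_countable']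
  exact tsum_congr fun k => by rw [Measure.map_apply ha (measurableSet_singleton k)]

lemma lintegral_label_sub_le {μ μ' : Measure X} [IsFiniteMeasure μ'] (h : μ' ≤ μ) {a : X → ℕ}
    (ha : Measurable a) {η : ℕ → ℝ≥0∞} (hη : ∀ k, μ (a ⁻¹' {k}) ≤ μ' (a ⁻¹' {k}) + η k) :
    ∫⁻ x, ((a x : ℝ≥0∞) + 1) ∂(μ - μ') ≤ ∑' k : ℕ, ((k : ℝ≥0∞) + 1) * η k := by
  rw [lintegral_label ha fun k => (k : ℝ≥0∞) + 1]
  refine ENNReal.tsum_le_tsum fun k => mul_le_mul_right ?_ _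
  rw [Measure.sub_apply (ha (measurableSet_singleton k)) h]
  exact tsub_le_iff_left.2 (hη k)

/-- Gluing measures `τ k j` that live on the blocks of the labels `a` and `l`, and whose images are
dominated by the blocks of a measure `α` with image `μ`: the image of the sum is dominated by `μ`,
and what it misses is controlled blockwise. -/
lemma map_le_and_lintegral_label_sub_le {Ω : Type*} [MeasurableSpace Ω] {μ : Measure X}
    [IsFiniteMeasure μ] {f : Ω → X} (hf : Measurable f) {a : X → ℕ} (ha : Measurable a) {l : Ω → ℕ}
    (hl : Measurable l) {α : Measure (X × ℕ)} (hα : α.map Prod.fst = μ) {τ : ℕ → ℕ → Measure Ω}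
    {η : ℕ → ℕ → ℝ≥0∞} (h0 : ∀ k j, τ k j {ω | a (f ω) = k ∧ l ω = j}ᶜ = 0)
    (hle : ∀ k j, (τ k j).map (fun ω => (f ω, l ω)) ≤ α.restrict ((a ⁻¹' {k}) ×ˢ {j}))
    (hη : ∀ k j, α ((a ⁻¹' {k}) ×ˢ {j}) ≤ τ k j univ + η k j) {σ : Measure Ω}
    (hσ : ∀ s, MeasurableSet s → σ s = ∑' k, ∑' j, τ k j s) :
    σ.map f ≤ μ ∧ ∫⁻ x, ((a x : ℝ≥0∞) + 1) ∂(μ - σ.map f) ≤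
      ∑' k : ℕ, ((k : ℝ≥0∞) + 1) * ∑' j, η k j := by
  have hA : ∀ k, MeasurableSet (a ⁻¹' {k}) := fun k => ha (measurableSet_singleton k)
  have hp : Measurable fun ω => (f ω, l ω) := hf.prodMk hl
  have hblocks : ∀ s : Set (X × ℕ), MeasurableSet s →
      α s = ∑' k, ∑' j, α (s ∩ (a ⁻¹' {k}) ×ˢ {j}) := by
    intro s hs
    rw [measure_eq_tsum_label α (ha.comp measurable_fst) hs]
    refine tsum_congr fun k => ?_
    rw [measure_eq_tsum_label α measurable_snd (hs.inter (ha.comp measurable_fst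
      (measurableSet_singleton k)))]
    refine tsum_congr fun j => congrArg α ?_
    rw [inter_assoc]
    rfl
  have hσμ : σ.map f ≤ μ := by
    refine Measure.le_iff.2 fun s hs => ?_
    rw [← hα, Measure.map_apply hf hs, Measure.map_apply measurable_fst hs, hσ _ (hf hs),
      hblocks _ (measurable_fst hs)]
    refine ENNReal.tsum_le_tsum fun k => ENNReal.tsum_le_tsum fun j => ?_
    have := hle k j (Prod.fst ⁻¹' s)
    rwa [Measure.map_apply hp (measurable_fst hs), Measure.restrict_apply (measurable_fst hs)]
      at this
  have hfin : IsFiniteMeasure (σ.map f) := isFiniteMeasure_of_le μ hσμ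
  refine ⟨hσμ, lintegral_label_sub_le hσμ ha fun k => ?_⟩
  have e1 : μ (a ⁻¹' {k}) = ∑' j, α ((a ⁻¹' {k}) ×ˢ {j}) := by
    rw [← hα, Measure.map_apply measurable_fst (hA k),
      measure_eq_tsum_label α measurable_snd (measurable_fst (hA k))]
    rfl
  have e2 : ∑' j, τ k j univ ≤ (σ.map f) (a ⁻¹' {k}) := by
    rw [Measure.map_apply hf (hA k), hσ _ (hf (hA k))]
    refine le_trans (ENNReal.tsum_le_tsum fun j => ?_) (ENNReal.le_tsum k)
    rw [← union_compl_self {ω | a (f ω) = k ∧ l ω = j}]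
    refine (measure_union_le _ _).trans ?_
    rw [h0, add_zero]
    exact measure_mono fun ω hω => hω.1
  rw [e1]
  refine (ENNReal.tsum_le_tsum fun j => hη k j).trans ?_
  rw [ENNReal.tsum_add]
  exact add_le_add e2 le_rfl

/-- If all truncations of the finite cost `c` have plans of arbitrarily small cost, then for any
labels there is a partial plan of small cost that leaves over little mass even when the mass is
weighted by the labels. The plan used on a block depends on the block. -/
lemma exists_partial_plan {μ : Measure X} {ν : Measure Y} [IsProbabilityMeasure μ]
    [IsProbabilityMeasure ν] {c : X × Y → ℝ≥0} (hc : Measurable c)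
    (h : ∀ n : ℕ, ∀ ε : ℝ≥0∞, ε ≠ 0 → ∃ π ∈ transportPlans μ ν, ∫⁻ z, min (c z : ℝ≥0∞) n ∂π ≤ ε)
    {a : X → ℕ} (ha : Measurable a) {b : Y → ℕ} (hb : Measurable b) {ε : ℝ≥0∞} (hε : ε ≠ 0) :
    ∃ σ : Measure (X × Y), σ.map Prod.fst ≤ μ ∧ σ.map Prod.snd ≤ ν ∧ ∫⁻ z, c z ∂σ ≤ ε ∧
      ∫⁻ x, ((a x : ℝ≥0∞) + 1) ∂(μ - σ.map Prod.fst) ≤ ε ∧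
      ∫⁻ y, ((b y : ℝ≥0∞) + 1) ∂(ν - σ.map Prod.snd) ≤ ε := by
  let G : ℕ → Set (Measure (X × Y)) := fun n =>
    {π | π ∈ transportPlans μ ν ∧ ∫⁻ z, min (c z : ℝ≥0∞) n ∂π ≤ ((n : ℝ≥0∞) + 1)⁻¹}
  obtain ⟨π, hπG, α, β, hα, hβ, hcl₁, hcl₂⟩ := exists_closeOn_of_antitone_convex (μ := μ) (ν := ν)
    ha hb G
    (by
      rintro m n hmn π ⟨h1, h2⟩
      refine ⟨h1, (lintegral_mono fun z => min_le_min le_rfl ?_).trans (h2.trans ?_)⟩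
      · exact_mod_cast hmn
      · rw [ENNReal.inv_le_inv]
        gcongr)
    (fun n => (h n _ (by simp)).imp fun π hπ => hπ)
    (fun n π hπ => hπ.1)
    (by
      rintro n π ⟨h1, h2⟩ π' ⟨h1', h2'⟩ s t hst
      refine ⟨⟨?_, ?_⟩, ?_⟩
      · rw [Measure.map_add _ _ measurable_fst, Measure.map_smul, Measure.map_smul, h1.1, h1'.1,
          ← add_smul, hst, one_smul]
      · rw [Measure.map_add _ _ measurable_snd, Measure.map_smul, Measure.map_smul, h1.2, h1'.2,
          ← add_smul, hst, one_smul]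
      · rw [lintegral_add_measure, lintegral_smul_measure, lintegral_smul_measure]
        calc s • ∫⁻ z, min (c z : ℝ≥0∞) n ∂π + t • ∫⁻ z, min (c z : ℝ≥0∞) n ∂π'
            ≤ s • ((n : ℝ≥0∞) + 1)⁻¹ + t • ((n : ℝ≥0∞) + 1)⁻¹ := by gcongr
          _ = ((n : ℝ≥0∞) + 1)⁻¹ := by rw [← add_smul, hst, one_smul])
  have fα : IsFiniteMeasure α := ⟨by
    rw [← preimage_univ (f := Prod.fst), ← Measure.map_apply measurable_fst .univ, hα]
    exact measure_lt_top _ _⟩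
  have fβ : IsFiniteMeasure β := ⟨by
    rw [← preimage_univ (f := Prod.fst), ← Measure.map_apply measurable_fst .univ, hβ]
    exact measure_lt_top _ _⟩
  -- the error allowed on a block, multiplied by its weight `w`, is summable to at most `ε`
  let w : ℕ × ℕ → ℝ≥0∞ := fun i => 4 * (((i.1 : ℝ≥0∞) + 1) * ((i.2 : ℝ≥0∞) + 1))
  have hw : ∀ i, w i ≠ ∞ := fun i => by
    simp only [w]
    finiteness
  obtain ⟨δ, hδ0, hδ⟩ := ENNReal.exists_pos_tsum_mul_lt_of_countable hε w hw
  have hblock : ∀ k j : ℕ, ∃ τ : Measure (X × Y), τ {z | a z.1 = k ∧ b z.2 = j}ᶜ = 0 ∧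
      τ.map (fun z => (z.1, b z.2)) ≤ α.restrict ((a ⁻¹' {k}) ×ˢ {j}) ∧
      τ.map (fun z => (z.2, a z.1)) ≤ β.restrict ((b ⁻¹' {j}) ×ˢ {k}) ∧
      ∫⁻ z, c z ∂τ ≤ δ (k, j) ∧ α ((a ⁻¹' {k}) ×ˢ {j}) ≤ τ univ + 4 * δ (k, j) ∧
      β ((b ⁻¹' {j}) ×ˢ {k}) ≤ τ univ + 4 * δ (k, j) := by
    intro k j
    have hδi : (δ (k, j) : ℝ≥0∞) ≠ 0 := by exact_mod_cast (hδ0 (k, j)).ne'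
    have hsmall : ∀ᶠ n : ℕ in atTop, ((n : ℝ≥0∞) + 1)⁻¹ ≤ δ (k, j) := by
      have h1 : Tendsto (fun n : ℕ => ((n : ℝ≥0∞))⁻¹) atTop (𝓝 0) :=
        ENNReal.tendsto_inv_nat_nhds_zero
      filter_upwards [h1.eventually (ge_mem_nhds (pos_iff_ne_zero.2 hδi))] with n hn
      exact le_trans (ENNReal.inv_le_inv.2 le_self_add) hn
    obtain ⟨n, h1, h2, h3, h4⟩ := ((hcl₁ j _ hδi).and ((hcl₂ k _ hδi).and
      (hsmall.and (eventually_ge_atTop 1)))).exists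
    exact exists_block_plan hc ha hb k j ENNReal.coe_ne_top h4 ((hπG n).2.trans h3) h1 h2
  choose τ hτ0 hτα hτβ hτc hτmα hτmβ using hblock
  let σ : Measure (X × Y) := Measure.sum fun i : ℕ × ℕ => τ i.1 i.2
  have hσ : ∀ s, MeasurableSet s → σ s = ∑' k, ∑' j, τ k j s := fun s hs => by
    rw [Measure.sum_apply _ hs, ENNReal.tsum_prod']
  obtain ⟨hσμ, hσa⟩ := map_le_and_lintegral_label_sub_le measurable_fst ha (hb.comp measurable_snd)
    hα hτ0 hτα hτmα hσ
  obtain ⟨hσν, hσb⟩ := map_le_and_lintegral_label_sub_le (τ := fun j k => τ k j)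
    (η := fun j k => 4 * (δ (k, j) : ℝ≥0∞)) measurable_snd hb (ha.comp measurable_fst) hβ
    (fun j k => (congrArg (τ k j) (by ext z; simp [and_comm])).trans (hτ0 k j)) (fun j k => hτβ k j)
    (fun j k => hτmβ k j) fun s hs => (hσ s hs).trans ENNReal.tsum_comm
  refine ⟨σ, hσμ, hσν, ?_, hσa.trans (le_trans ?_ hδ.le), hσb.trans (le_trans ?_ hδ.le)⟩
  · rw [lintegral_sum_measure]
    refine (ENNReal.tsum_le_tsum fun i => ?_).trans hδ.le
    refine (hτc i.1 i.2).trans (le_mul_of_one_le_left zero_le ?_)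
    simp only [w]
    calc (1 : ℝ≥0∞) = 1 * (1 * 1) := by simp
      _ ≤ _ := by
        gcongr
        · norm_num
        · exact le_add_self
        · exact le_add_self
  · rw [ENNReal.tsum_prod']
    refine ENNReal.tsum_le_tsum fun k => ?_
    rw [← ENNReal.tsum_mul_left]
    refine ENNReal.tsum_le_tsum fun j => ?_
    simp only [w]
    calc ((k : ℝ≥0∞) + 1) * (4 * δ (k, j)) = 4 * (((k : ℝ≥0∞) + 1) * 1) * δ (k, j) := by ring
      _ ≤ _ := by gcongr; exact le_add_self
  · rw [ENNReal.tsum_prod', ENNReal.tsum_comm]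
    refine ENNReal.tsum_le_tsum fun j => ?_
    rw [← ENNReal.tsum_mul_left]
    refine ENNReal.tsum_le_tsum fun k => ?_
    simp only [w]
    calc ((j : ℝ≥0∞) + 1) * (4 * δ (k, j)) = 4 * (1 * ((j : ℝ≥0∞) + 1)) * δ (k, j) := by ring
      _ ≤ _ := by gcongr; exact le_add_self

end Glue

/-! ### Completing a partial plan -/

section Completion

variable {X Y : Type*} [MeasurableSpace X] [MeasurableSpace Y]

lemma exists_nat_measure_gt_le {m : Measure X} [IsFiniteMeasure m] {f : X → ℝ≥0}
    (hf : Measurable f) {θ : ℝ≥0∞} (hθ : θ ≠ 0) : ∃ n : ℕ, m {x | (n : ℝ≥0) < f x} ≤ θ := by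
  have hlim := tendsto_measure_iInter_atTop (μ := m) (s := fun n : ℕ => {x | (n : ℝ≥0) < f x})
    (fun n => (measurableSet_lt measurable_const hf).nullMeasurableSet)
    (fun i j hij x (hx : (j : ℝ≥0) < f x) => lt_of_le_of_lt (by exact_mod_cast hij) hx)
    ⟨0, measure_ne_top _ _⟩
  have hempty : ⋂ n : ℕ, {x | (n : ℝ≥0) < f x} = ∅ := by
    refine eq_empty_of_forall_notMem fun x hx => ?_
    obtain ⟨n, hn⟩ := exists_nat_ge (f x)
    exact absurd (mem_iInter.1 hx n) (not_lt.2 hn)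
  rw [hempty, measure_empty] at hlim
  exact (hlim.eventually (ge_mem_nhds (pos_iff_ne_zero.2 hθ))).exists

/-- A finite cost is bounded, from each point `x`, by a label `a(x)` on most of the other space. -/
lemma exists_label {ν : Measure Y} [IsFiniteMeasure ν] {c : X × Y → ℝ≥0} (hc : Measurable c)
    {θ : ℝ≥0∞} (hθ : θ ≠ 0) :
    ∃ a : X → ℕ, Measurable a ∧ ∀ x, ν {y | (a x : ℝ≥0) < c (x, y)} ≤ θ := by
  classical
  have hex : ∀ x, ∃ n : ℕ, ν {y | (n : ℝ≥0) < c (x, y)} ≤ θ := fun x =>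
    exists_nat_measure_gt_le (hc.comp measurable_prodMk_left) hθ
  refine ⟨fun x => Nat.find (hex x), measurable_find hex fun n => ?_,
    fun x => Nat.find_spec (hex x)⟩
  exact measurableSet_le (measurable_measure_prodMk_left (measurableSet_lt measurable_const hc))
    measurable_const

lemma le_real_of_measure_compl_le {Z : Type*} [MeasurableSpace Z] {m : Measure Z}
    [IsProbabilityMeasure m] {s : Set Z} (hs : MeasurableSet s) (h : 8 * m sᶜ ≤ 1) :
    7 / 8 ≤ m.real s := by
  have h1 : (8 * m sᶜ).toReal ≤ (1 : ℝ≥0∞).toReal := ENNReal.toReal_mono ENNReal.one_ne_top h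
  rw [ENNReal.toReal_mul] at h1
  have h2 := probReal_compl_eq_one_sub (μ := m) hs
  rw [measureReal_def] at h2
  norm_num at h1
  linarith

/-- The continuous marriage lemma for finite measures of equal mass. -/
lemma exists_plan_of_dense_relation_of_finite {P : Measure X} {Q : Measure Y} [IsFiniteMeasure P]
    [IsFiniteMeasure Q] (hPQ : P univ = Q univ) (hP0 : P univ ≠ 0) {R : Set (X × Y)}
    (hR : MeasurableSet R) (hx : ∀ x, 8 * Q {y | (x, y) ∈ R}ᶜ ≤ Q univ)
    (hy : ∀ y, 8 * P {x | (x, y) ∈ R}ᶜ ≤ P univ) : ∃ π ∈ transportPlans P Q, π Rᶜ = 0 := by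
  have hPt : P univ ≠ ∞ := measure_ne_top _ _
  have hinv : (P univ)⁻¹ * P univ = 1 := ENNReal.inv_mul_cancel hP0 hPt
  have hP : IsProbabilityMeasure ((P univ)⁻¹ • P) := ⟨by rwa [Measure.smul_apply, smul_eq_mul]⟩
  have hQ : IsProbabilityMeasure ((P univ)⁻¹ • Q) := ⟨by
    rwa [Measure.smul_apply, smul_eq_mul, ← hPQ]⟩
  obtain ⟨π, hπ, hπR⟩ := exists_plan_of_dense_relation (P := (P univ)⁻¹ • P)
    (Q := (P univ)⁻¹ • Q) hR
    (fun x => le_real_of_measure_compl_le (measurable_prodMk_left hR) (by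
      rw [Measure.smul_apply, smul_eq_mul, ← hinv, mul_left_comm]
      gcongr
      exact (hx x).trans hPQ.ge))
    (fun y => le_real_of_measure_compl_le (measurable_prodMk_right hR) (by
      rw [Measure.smul_apply, smul_eq_mul, ← hinv, mul_left_comm]
      gcongr
      exact hy y))
  refine ⟨P univ • π, ⟨?_, ?_⟩, by rw [Measure.smul_apply, hπR, smul_zero]⟩
  · rw [Measure.map_smul, hπ.1, smul_smul, ENNReal.mul_inv_cancel hP0 hPt, one_smul]
  · rw [Measure.map_smul, hπ.2, smul_smul, ENNReal.mul_inv_cancel hP0 hPt, one_smul]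

/-- If all truncations of the finite cost `c` have plans of arbitrarily small cost, then so does
`c` itself. The partial plans of `exists_partial_plan` are completed as follows: a small fraction
`t` of the part of the plan that lives on points with bounded labels is released, which makes the
masses left over on both sides large compared with the exceptional sets of the labels, so that the
continuous marriage lemma couples them within `{c ≤ a + b}`. -/
lemma exists_plan_lintegral_le {μ : Measure X} {ν : Measure Y} [IsProbabilityMeasure μ]
    [IsProbabilityMeasure ν] {c : X × Y → ℝ≥0} (hc : Measurable c)
    (h : ∀ n : ℕ, ∀ ε : ℝ≥0∞, ε ≠ 0 → ∃ π ∈ transportPlans μ ν, ∫⁻ z, min (c z : ℝ≥0∞) n ∂π ≤ ε)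
    {ε : ℝ≥0∞} (hε : ε ≠ 0) : ∃ π ∈ transportPlans μ ν, ∫⁻ z, c z ∂π ≤ ε := by
  -- the marriage lemma needs eight times the exceptional mass, here two terms of at most `t * θ`, to
  -- be below the mass to be coupled, here at least `t / 4`
  let θ : ℝ≥0 := 1 / 64
  have hθ0 : (θ : ℝ≥0∞) ≠ 0 := by
    rw [ENNReal.coe_ne_zero]
    norm_num [θ]
  obtain ⟨a, ha, hac⟩ := exists_label (ν := ν) hc hθ0
  obtain ⟨b, hb, hbc⟩ := exists_label (ν := μ) (c := c ∘ Prod.swap) (hc.comp measurable_swap) hθ0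
  obtain ⟨K₁, hK₁⟩ := exists_nat_measure_gt_le (m := μ) (f := fun x => (a x : ℝ≥0))
    (by fun_prop) hθ0
  obtain ⟨K₂, hK₂⟩ := exists_nat_measure_gt_le (m := ν) (f := fun y => (b y : ℝ≥0))
    (by fun_prop) hθ0
  obtain ⟨t, ht0, ht1, htK⟩ : ∃ t : ℝ≥0, t ≠ 0 ∧ t ≤ 1 ∧
      (t : ℝ≥0∞) * (K₁ + K₂ : ℝ≥0) ≤ ε / 2 := by
    have hlim : Tendsto (fun t : ℝ≥0 => (t : ℝ≥0∞) * (K₁ + K₂ : ℝ≥0)) (𝓝[>] 0) (𝓝 0) := by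
      have : Continuous fun t : ℝ≥0 => ((t * (K₁ + K₂) : ℝ≥0) : ℝ≥0∞) := by fun_prop
      have := this.tendsto 0
      simp only [ENNReal.coe_mul, ENNReal.coe_zero, zero_mul] at this
      exact this.mono_left nhdsWithin_le_nhds
    have hε2 : 0 < ε / 2 := ENNReal.half_pos hε
    obtain ⟨t, h1, h2⟩ := ((hlim.eventually (ge_mem_nhds hε2)).and
      (Ioc_mem_nhdsGT (zero_lt_one (α := ℝ≥0)))).exists
    exact ⟨t, h2.1.ne', h2.2, h1⟩
  have ht0' : (t : ℝ≥0∞) ≠ 0 := by exact_mod_cast ht0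
  set ε₁ : ℝ≥0∞ := min (t * θ) (ε / 6)
  have hε₁ : ε₁ ≠ 0 := by
    refine (lt_min ?_ ?_).ne'
    · exact pos_iff_ne_zero.2 (mul_ne_zero ht0' hθ0)
    · exact ENNReal.div_pos hε (by norm_num)
  have hε₁t : ε₁ ≤ t * θ := min_le_left _ _
  obtain ⟨σ, hσμ, hσν, hσc, hσa, hσb⟩ := exists_partial_plan hc h ha hb hε₁
  have f1 : IsFiniteMeasure (σ.map Prod.fst) := isFiniteMeasure_of_le μ hσμ
  have f2 : IsFiniteMeasure (σ.map Prod.snd) := isFiniteMeasure_of_le ν hσν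
  have fσ : IsFiniteMeasure σ := ⟨by
    rw [← preimage_univ (f := Prod.fst), ← Measure.map_apply measurable_fst .univ]
    exact measure_lt_top _ _⟩
  set μ' := μ - σ.map Prod.fst
  set ν' := ν - σ.map Prod.snd
  have eμ : μ' + σ.map Prod.fst = μ := Measure.sub_add_cancel_of_le hσμ
  have eν : ν' + σ.map Prod.snd = ν := Measure.sub_add_cancel_of_le hσν
  have hμ'm : μ' univ ≤ ε₁ := by
    refine le_trans ?_ hσa
    rw [← lintegral_one]
    exact lintegral_mono fun x => le_add_self
  have hν'm : ν' univ ≤ ε₁ := by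
    refine le_trans ?_ hσb
    rw [← lintegral_one]
    exact lintegral_mono fun x => le_add_self
  have hσmass : (σ.map Prod.fst) univ = σ univ := by
    rw [Measure.map_apply measurable_fst .univ, preimage_univ]
  have hσmass' : (σ.map Prod.snd) univ = σ univ := by
    rw [Measure.map_apply measurable_snd .univ, preimage_univ]
  -- the part `G` of the plan that lives on points with bounded labels
  let B : Set (X × Y) := {z | (a z.1 : ℝ≥0) ≤ K₁ ∧ (b z.2 : ℝ≥0) ≤ K₂}
  have hB : MeasurableSet B := (measurableSet_le (by fun_prop) measurable_const).inter
    (measurableSet_le (by fun_prop) measurable_const)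
  set G := σ.restrict B with hG
  have hGB : ∀ᵐ z ∂G, z ∈ B := ae_restrict_mem hB
  have hGσ : G ≤ σ := Measure.restrict_le_self
  have hGμ : G.map Prod.fst ≤ μ := (Measure.map_mono hGσ measurable_fst).trans hσμ
  have hGν : G.map Prod.snd ≤ ν := (Measure.map_mono hGσ measurable_snd).trans hσν
  have hG1 : (G.map Prod.fst) univ = G univ := by
    rw [Measure.map_apply measurable_fst .univ, preimage_univ]
  have hG2 : (G.map Prod.snd) univ = G univ := by
    rw [Measure.map_apply measurable_snd .univ, preimage_univ]
  have hGle : G univ ≤ 1 := by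
    rw [← hG1]
    exact (hGμ univ).trans measure_univ.le
  have hθt : (t : ℝ≥0∞) * θ ≤ θ := by
    exact_mod_cast mul_le_of_le_one_left (zero_le) ht1
  have hGlarge : (1 / 4 : ℝ≥0) ≤ G univ := by
    have h1 : (1 : ℝ≥0∞) ≤ G univ + 3 * θ := by
      calc (1 : ℝ≥0∞) = μ' univ + σ univ := by
            rw [← hσmass, ← Measure.add_apply, eμ, measure_univ]
        _ ≤ θ + (G univ + (θ + θ)) := by
            refine add_le_add (hμ'm.trans (hε₁t.trans hθt)) ?_
            rw [hG, Measure.restrict_apply_univ, ← measure_add_measure_compl hB]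
            refine add_le_add le_rfl ?_
            refine (measure_mono (t := Prod.fst ⁻¹' {x | (K₁ : ℝ≥0) < a x} ∪
              Prod.snd ⁻¹' {y | (K₂ : ℝ≥0) < b y}) fun z hz => ?_).trans
              ((measure_union_le _ _).trans (add_le_add ?_ ?_))
            · by_contra hcon
              rw [mem_union, not_or] at hcon
              exact hz ⟨not_lt.1 hcon.1, not_lt.1 hcon.2⟩
            · rw [← Measure.map_apply measurable_fst
                (measurableSet_lt measurable_const (by fun_prop))]
              exact (hσμ _).trans hK₁
            · rw [← Measure.map_apply measurable_snd
                (measurableSet_lt measurable_const (by fun_prop))]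
              exact (hσν _).trans hK₂
        _ = G univ + 3 * θ := by ring
    lift G univ to ℝ≥0 using measure_ne_top _ _ with g
    have h2 : 1 ≤ g + 3 * θ := by exact_mod_cast h1
    have h3 : (1 : ℝ) ≤ g + 3 * (1 / 64) := by exact_mod_cast h2
    rw [ENNReal.coe_le_coe, ← NNReal.coe_le_coe]
    push_cast
    linarith
  -- the left over masses
  let P := μ' + (t : ℝ≥0∞) • G.map Prod.fst
  let Q := ν' + (t : ℝ≥0∞) • G.map Prod.snd
  have fμ' : IsFiniteMeasure μ' := isFiniteMeasure_of_le μ Measure.sub_le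
  have fν' : IsFiniteMeasure ν' := isFiniteMeasure_of_le ν Measure.sub_le
  have fP : IsFiniteMeasure P := by
    have : IsFiniteMeasure ((t : ℝ≥0∞) • G.map Prod.fst) := Measure.smul_finite _ ENNReal.coe_ne_top
    infer_instance
  have fQ : IsFiniteMeasure Q := by
    have : IsFiniteMeasure ((t : ℝ≥0∞) • G.map Prod.snd) := Measure.smul_finite _ ENNReal.coe_ne_top
    infer_instance
  have hPu : P univ = μ' univ + t * G univ := by
    simp only [P, Measure.add_apply, Measure.smul_apply, smul_eq_mul, hG1]
  have hQu : Q univ = ν' univ + t * G univ := by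
    simp only [Q, Measure.add_apply, Measure.smul_apply, smul_eq_mul, hG2]
  have hμν' : μ' univ = ν' univ := by
    have m1 := congrArg (· univ) eμ
    have m2 := congrArg (· univ) eν
    simp only [Measure.add_apply, measure_univ, hσmass, hσmass'] at m1 m2
    exact (ENNReal.add_left_inj (measure_ne_top σ univ)).1 (m1.trans m2.symm)
  have htG : 8 * (t * θ + t * θ : ℝ≥0∞) ≤ t * G univ := by
    calc 8 * (t * θ + t * θ : ℝ≥0∞) = t * ((8 * (θ + θ) : ℝ≥0) : ℝ≥0∞) := by push_cast; ring
      _ = t * (1 / 4 : ℝ≥0) := by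
          congr 2
          ext
          norm_num [θ]
      _ ≤ t * G univ := by gcongr
  have hPQ : P univ = Q univ := by rw [hPu, hQu, hμν']
  have hP0 : P univ ≠ 0 := by
    rw [hPu]
    refine (lt_of_lt_of_le (pos_iff_ne_zero.2 (mul_ne_zero ht0' ?_)) le_add_self).ne'
    refine (lt_of_lt_of_le ?_ hGlarge).ne'
    rw [ENNReal.coe_pos]
    norm_num
  let R : Set (X × Y) := {z | c z ≤ (a z.1 : ℝ≥0) + b z.2}
  have hR : MeasurableSet R := measurableSet_le hc (by fun_prop)
  obtain ⟨p, hp, hpR⟩ := exists_plan_of_dense_relation_of_finite hPQ hP0 hR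
    (fun x => by
      refine le_trans ?_ (htG.trans (hQu ▸ le_add_self))
      gcongr
      refine (measure_mono (t := {y | (a x : ℝ≥0) < c (x, y)}) fun y hy => ?_).trans ?_
      · exact lt_of_le_of_lt le_self_add
          (not_le.1 (show ¬ c (x, y) ≤ (a x : ℝ≥0) + b y from hy))
      · simp only [Q, Measure.add_apply, Measure.smul_apply, smul_eq_mul]
        refine add_le_add ((measure_mono (subset_univ _)).trans (hν'm.trans hε₁t)) ?_
        gcongr
        exact (hGν _).trans (hac x))
    (fun y => by
      refine le_trans ?_ (htG.trans (hPu ▸ le_add_self))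
      gcongr
      refine (measure_mono (t := {x | (b y : ℝ≥0) < c (x, y)}) fun x hx => ?_).trans ?_
      · exact lt_of_le_of_lt le_add_self
          (not_le.1 (show ¬ c (x, y) ≤ (a x : ℝ≥0) + b y from hx))
      · simp only [P, Measure.add_apply, Measure.smul_apply, smul_eq_mul]
        refine add_le_add ((measure_mono (subset_univ _)).trans (hμ'm.trans hε₁t)) ?_
        gcongr
        exact (hGμ _).trans (hbc y))
  have ht1' : (t : ℝ≥0∞) ≤ 1 := by exact_mod_cast ht1
  let σ' := σ.restrict Bᶜ + (1 - t : ℝ≥0∞) • G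
  have hσ'σ : σ' + (t : ℝ≥0∞) • G = σ := by
    simp only [σ']
    rw [add_assoc, ← add_smul, tsub_add_cancel_of_le ht1', one_smul, hG, add_comm,
      Measure.restrict_add_restrict_compl hB]
  have hσ'le : σ' ≤ σ := by
    conv_rhs => rw [← hσ'σ]
    exact Measure.le_add_right le_rfl
  refine ⟨σ' + p, ?_, ?_⟩
  · have hmem := add_mem_transportPlans (show σ' ∈ transportPlans _ _ from ⟨rfl, rfl⟩) hp
    have g1 : σ'.map Prod.fst + P = μ := by
      simp only [P]
      rw [← Measure.map_smul, add_left_comm, ← Measure.map_add _ _ measurable_fst, hσ'σ, eμ]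
    have g2 : σ'.map Prod.snd + Q = ν := by
      simp only [Q]
      rw [← Measure.map_smul, add_left_comm, ← Measure.map_add _ _ measurable_snd, hσ'σ, eν]
    rwa [g1, g2] at hmem
  · have hcost : ∫⁻ z, c z ∂p ≤ ∫⁻ x, a x ∂P + ∫⁻ y, b y ∂Q := by
      have hpR' : ∀ᵐ z ∂p, z ∈ R := hpR
      calc ∫⁻ z, c z ∂p ≤ ∫⁻ z, ((a z.1 : ℝ≥0∞) + b z.2) ∂p := by
            refine lintegral_mono_ae (hpR'.mono fun z hz => ?_)
            exact_mod_cast (show c z ≤ (a z.1 : ℝ≥0) + b z.2 from hz)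
        _ = ∫⁻ z, (a z.1 : ℝ≥0∞) ∂p + ∫⁻ z, (b z.2 : ℝ≥0∞) ∂p :=
            lintegral_add_left (by fun_prop) _
        _ = ∫⁻ x, a x ∂P + ∫⁻ y, b y ∂Q := by
            rw [← hp.1, ← hp.2, lintegral_map (by fun_prop) measurable_fst,
              lintegral_map (by fun_prop) measurable_snd]
    have hPa : ∫⁻ x, a x ∂P ≤ ε₁ + t * K₁ := by
      simp only [P]
      rw [lintegral_add_measure, lintegral_smul_measure]
      refine add_le_add ((lintegral_mono fun x => le_self_add).trans hσa) ?_
      rw [lintegral_map (by fun_prop) measurable_fst, smul_eq_mul]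
      gcongr
      calc ∫⁻ z, (a z.1 : ℝ≥0∞) ∂G ≤ ∫⁻ _, (K₁ : ℝ≥0∞) ∂G :=
            lintegral_mono_ae (hGB.mono fun z hz => by exact_mod_cast hz.1)
        _ = K₁ * G univ := lintegral_const _
        _ ≤ K₁ := mul_le_of_le_one_right zero_le hGle
    have hQb : ∫⁻ y, b y ∂Q ≤ ε₁ + t * K₂ := by
      simp only [Q]
      rw [lintegral_add_measure, lintegral_smul_measure]
      refine add_le_add ((lintegral_mono fun x => le_self_add).trans hσb) ?_
      rw [lintegral_map (by fun_prop) measurable_snd, smul_eq_mul]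
      gcongr
      calc ∫⁻ z, (b z.2 : ℝ≥0∞) ∂G ≤ ∫⁻ _, (K₂ : ℝ≥0∞) ∂G :=
            lintegral_mono_ae (hGB.mono fun z hz => by exact_mod_cast hz.2)
        _ = K₂ * G univ := lintegral_const _
        _ ≤ K₂ := mul_le_of_le_one_right zero_le hGle
    rw [lintegral_add_measure]
    calc ∫⁻ z, c z ∂σ' + ∫⁻ z, c z ∂p
        ≤ ε₁ + ((ε₁ + t * K₁) + (ε₁ + t * K₂)) :=
          add_le_add ((lintegral_mono' hσ'le le_rfl).trans hσc)
            (hcost.trans (add_le_add hPa hQb))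
      _ = 3 * ε₁ + t * (K₁ + K₂ : ℝ≥0) := by push_cast; ring
      _ ≤ 3 * (ε / 6) + ε / 2 := by
          gcongr
          exact min_le_right _ _
      _ = ε := by
          have : 3 * (ε / 6) = ε / 2 := by
            rw [← mul_div_assoc, mul_comm, show (6 : ℝ≥0∞) = 2 * 3 by norm_num]
            exact ENNReal.mul_div_mul_right _ _ (by norm_num) (by norm_num)
          rw [this, ENNReal.add_halves]

end Completion

/-! ### Extended integrals -/

section ExtIntegral

variable {Ω : Type*} [MeasurableSpace Ω] {π : Measure Ω} {f g u : Ω → ℝ}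

lemma extIntegral_of_integrable (hf : Integrable f π) :
    extIntegral π f = ((∫ ω, f ω ∂π : ℝ) : EReal) := by
  have h1 : ∫⁻ ω, ENNReal.ofReal (f ω) ∂π ≠ ∞ := hf.lintegral_lt_top.ne
  have h2 : ∫⁻ ω, ENNReal.ofReal (-f ω) ∂π ≠ ∞ := hf.neg.lintegral_lt_top.ne
  rw [integral_eq_lintegral_pos_part_sub_lintegral_neg_part hf, EReal.coe_sub, extIntegral,
    EReal.coe_ennreal_toReal h1, EReal.coe_ennreal_toReal h2]

lemma lintegral_neg_ne_top (hg : Integrable g π) (hgf : ∀ᵐ ω ∂π, g ω ≤ f ω) :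
    ∫⁻ ω, ENNReal.ofReal (-f ω) ∂π ≠ ∞ := by
  refine ((lintegral_mono_ae ?_).trans_lt hg.neg.lintegral_lt_top).ne
  filter_upwards [hgf] with ω h
  exact ENNReal.ofReal_le_ofReal (neg_le_neg h)

lemma extIntegral_eq_top (hf : AEStronglyMeasurable f π) (hg : Integrable g π)
    (hgf : ∀ᵐ ω ∂π, g ω ≤ f ω) (hnot : ¬ Integrable f π) : extIntegral π f = ⊤ := by
  have h2 := lintegral_neg_ne_top hg hgf
  have h1 : ∫⁻ ω, ENNReal.ofReal (f ω) ∂π = ∞ := by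
    by_contra h1
    refine hnot ⟨hf, ?_⟩
    rw [hasFiniteIntegral_iff_norm]
    calc ∫⁻ ω, ENNReal.ofReal ‖f ω‖ ∂π
        ≤ ∫⁻ ω, (ENNReal.ofReal (f ω) + ENNReal.ofReal (-f ω)) ∂π := by
          refine lintegral_mono fun ω => ?_
          rcases le_total 0 (f ω) with h | h
          · rw [Real.norm_of_nonneg h]; exact le_self_add
          · rw [Real.norm_of_nonpos h]; exact le_add_self
      _ = ∫⁻ ω, ENNReal.ofReal (f ω) ∂π + ∫⁻ ω, ENNReal.ofReal (-f ω) ∂π :=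
          lintegral_add_left' hf.aemeasurable.ennreal_ofReal _
      _ < ∞ := ENNReal.add_lt_top.2 ⟨lt_top_iff_ne_top.2 h1, lt_top_iff_ne_top.2 h2⟩
  rw [extIntegral, h1, ← EReal.coe_ennreal_toReal h2, EReal.coe_ennreal_top]
  exact EReal.top_sub_coe _

lemma extIntegral_add (hu : Integrable u π) (hf : AEStronglyMeasurable f π) (hg : Integrable g π)
    (hgf : ∀ᵐ ω ∂π, g ω ≤ f ω) :
    extIntegral π (fun ω => u ω + f ω) = ((∫ ω, u ω ∂π : ℝ) : EReal) + extIntegral π f := by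
  by_cases h : Integrable f π
  · have hadd : Integrable (fun ω => u ω + f ω) π := hu.add h
    rw [extIntegral_of_integrable h, extIntegral_of_integrable hadd, integral_add hu h,
      EReal.coe_add]
  · have h' : ¬ Integrable (fun ω => u ω + f ω) π := fun h' =>
      h ((h'.sub hu).congr (ae_of_all _ fun ω => by simp))
    rw [extIntegral_eq_top hf hg hgf h, extIntegral_eq_top (f := fun ω => u ω + f ω)
      (hu.1.add hf) (hu.add hg) ?_ h', EReal.coe_add_top]
    filter_upwards [hgf] with ω hω
    exact add_le_add le_rfl hω

lemma extIntegral_neg (hg : Integrable g π) (hgf : ∀ᵐ ω ∂π, g ω ≤ f ω) :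
    extIntegral π (fun ω => -f ω) = -extIntegral π f := by
  have h2 := lintegral_neg_ne_top hg hgf
  simp only [extIntegral, neg_neg]
  rw [EReal.neg_sub (Or.inl (by simp)) (Or.inr (by simpa using h2)), add_comm, sub_eq_add_neg]

end ExtIntegral

lemma iInf_coe_add {ι : Type*} (S : Set ι) (r : ℝ) (F : ι → EReal) :
    ⨅ i ∈ S, ((r : EReal) + F i) = r + ⨅ i ∈ S, F i := by
  have key : ∀ (r : ℝ) (F : ι → EReal), (r : EReal) + ⨅ i ∈ S, F i ≤ ⨅ i ∈ S, ((r : EReal) + F i) :=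
    fun r F => le_iInf₂ fun i hi => add_le_add le_rfl (iInf₂_le i hi)
  have hcancel : ∀ (s : ℝ) (x : EReal), (s : EReal) + (((-s : ℝ) : EReal) + x) = x := by
    intro s x
    rw [← add_assoc, ← EReal.coe_add, add_neg_cancel, EReal.coe_zero, zero_add]
  have hcancel' : ∀ x : EReal, ((-r : ℝ) : EReal) + ((r : EReal) + x) = x := fun x => by
    simpa using hcancel (-r) x
  refine le_antisymm ?_ (key r F)
  have := key (-r) fun i => (r : EReal) + F i
  simp only [hcancel'] at this
  rw [← hcancel r (⨅ i ∈ S, ((r : EReal) + F i))]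
  exact add_le_add le_rfl this

/-! ### Weak duality -/

lemma mem_admissiblePairs_Tminus {X Y : Type*} {c : X → Y → ℝ} {φ : X → ℝ}
    (hφ : ∀ y, BddBelow (range fun x => φ x + c x y)) : (φ, Tminus c φ) ∈ admissiblePairs c :=
  fun x y => sub_le_iff_le_add'.2 (ciInf_le (hφ y) x)

section Weak

variable {X Y : Type*} [MeasurableSpace X] [MeasurableSpace Y] {μ : Measure X} {ν : Measure Y}
  {π : Measure (X × Y)}

lemma integrable_fst_of_mem_transportPlans (hπ : π ∈ transportPlans μ ν) {φ : X → ℝ}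
    (hφ : Integrable φ μ) : Integrable (fun z => φ z.1) π := by
  rw [← hπ.1] at hφ
  exact hφ.comp_measurable measurable_fst

lemma integrable_snd_of_mem_transportPlans (hπ : π ∈ transportPlans μ ν) {ψ : Y → ℝ}
    (hψ : Integrable ψ ν) : Integrable (fun z => ψ z.2) π := by
  rw [← hπ.2] at hψ
  exact hψ.comp_measurable measurable_snd

lemma integral_fst_of_mem_transportPlans (hπ : π ∈ transportPlans μ ν) {φ : X → ℝ}
    (hφ : Integrable φ μ) : ∫ z, φ z.1 ∂π = ∫ x, φ x ∂μ := by
  rw [← hπ.1] at hφ ⊢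
  exact (integral_map measurable_fst.aemeasurable hφ.1).symm

lemma integral_snd_of_mem_transportPlans (hπ : π ∈ transportPlans μ ν) {ψ : Y → ℝ}
    (hψ : Integrable ψ ν) : ∫ z, ψ z.2 ∂π = ∫ y, ψ y ∂ν := by
  rw [← hπ.2] at hψ ⊢
  exact (integral_map measurable_snd.aemeasurable hψ.1).symm

lemma isProbabilityMeasure_of_mem_transportPlans [IsProbabilityMeasure μ]
    (hπ : π ∈ transportPlans μ ν) : IsProbabilityMeasure π :=
  ⟨by rw [measure_univ_eq_of_mem_transportPlans hπ]; exact measure_univ⟩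

variable [IsProbabilityMeasure μ] {c : X → Y → ℝ}

lemma dualValue_le_kantorovichCost (hc : Measurable fun z : X × Y => c z.1 z.2)
    (hbdd : ∃ K : ℝ, ∀ x y, K ≤ c x y) {φ : X → ℝ} {ψ : Y → ℝ}
    (h : (φ, ψ) ∈ admissiblePairs c) (hφ : Integrable φ μ) (hψ : Integrable ψ ν) :
    ((dualValue μ ν φ ψ : ℝ) : EReal) ≤ kantorovichCost c μ ν := by
  obtain ⟨K, hK⟩ := hbdd
  refine le_iInf₂ fun π hπ => ?_
  have := isProbabilityMeasure_of_mem_transportPlans hπ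
  by_cases hint : Integrable (fun z : X × Y => c z.1 z.2) π
  · rw [extIntegral_of_integrable hint, EReal.coe_le_coe_iff, dualValue,
      ← integral_fst_of_mem_transportPlans hπ hφ, ← integral_snd_of_mem_transportPlans hπ hψ,
      ← integral_sub (integrable_snd_of_mem_transportPlans hπ hψ)
        (integrable_fst_of_mem_transportPlans hπ hφ)]
    exact integral_mono ((integrable_snd_of_mem_transportPlans hπ hψ).sub
      (integrable_fst_of_mem_transportPlans hπ hφ)) hint fun z => h z.1 z.2
  · rw [extIntegral_eq_top hc.aestronglyMeasurable (integrable_const K)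
      (ae_of_all _ fun z => hK z.1 z.2) hint]
    exact le_top

/-- Adding an integrable `φ(x)` to the cost shifts the optimal cost by `∫ φ dμ`. -/
lemma iInf_extIntegral_add (hc : Measurable fun z : X × Y => c z.1 z.2)
    (hbdd : ∃ K : ℝ, ∀ x y, K ≤ c x y) {φ : X → ℝ} (hφ : Integrable φ μ) :
    ⨅ π ∈ transportPlans μ ν, extIntegral π (fun z => φ z.1 + c z.1 z.2) =
      ((∫ x, φ x ∂μ : ℝ) : EReal) + kantorovichCost c μ ν := by
  obtain ⟨K, hK⟩ := hbdd
  rw [kantorovichCost, ← iInf_coe_add]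
  refine iInf_congr fun π => iInf_congr fun hπ => ?_
  have := isProbabilityMeasure_of_mem_transportPlans hπ
  rw [extIntegral_add (integrable_fst_of_mem_transportPlans hπ hφ) hc.aestronglyMeasurable
    (integrable_const K) (ae_of_all _ fun z => hK z.1 z.2),
    integral_fst_of_mem_transportPlans hπ hφ]

lemma SolvesKminus.solvesKR (hc : Measurable fun z : X × Y => c z.1 z.2)
    (hbdd : ∃ K : ℝ, ∀ x y, K ≤ c x y) {φ : X → ℝ} (h : SolvesKminus c μ ν φ) :
    SolvesKR c μ ν φ (Tminus c φ) ∧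
      ((dualValue μ ν φ (Tminus c φ) : ℝ) : EReal) = kantorovichCost c μ ν := by
  obtain ⟨hφ, hb, hT, heq⟩ := h
  rw [iInf_extIntegral_add hc hbdd hφ] at heq
  have hval : ((dualValue μ ν φ (Tminus c φ) : ℝ) : EReal) = kantorovichCost c μ ν := by
    rw [dualValue, sub_eq_neg_add, EReal.coe_add, heq, ← add_assoc, ← EReal.coe_add, neg_add_cancel,
      EReal.coe_zero, zero_add]
  refine ⟨⟨mem_admissiblePairs_Tminus hb, hφ, hT, fun φ' ψ' h' hφ' hψ' => ?_⟩, hval⟩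
  have := dualValue_le_kantorovichCost hc hbdd h' hφ' hψ'
  rwa [← hval, EReal.coe_le_coe_iff] at this

end Weak

/-! ### Strong duality at a maximizer of the dual problem -/

section Strong

variable {X Y : Type*} [TopologicalSpace X] [PolishSpace X] [MeasurableSpace X] [BorelSpace X]
  [TopologicalSpace Y] [PolishSpace Y] [MeasurableSpace Y] [BorelSpace Y]
  {μ : Measure X} {ν : Measure Y} [IsProbabilityMeasure μ] [IsProbabilityMeasure ν]
  {c : X → Y → ℝ} {φ : X → ℝ} {ψ : Y → ℝ}

/-- At a maximizer `(φ, ψ)` of the dual problem, the reduced cost `φ(x) + c(x, y) - ψ(y)` has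
plans of arbitrarily small cost. It is represented by a Borel function `d`, which agrees with it
almost everywhere for every plan. -/
lemma SolvesKR.exists_reduced_cost (hc : Measurable fun z : X × Y => c z.1 z.2)
    (h : SolvesKR c μ ν φ ψ) :
    ∃ d : X × Y → ℝ≥0, Measurable d ∧
      (∀ π ∈ transportPlans μ ν, ∀ᵐ z ∂π, (d z : ℝ) = φ z.1 + c z.1 z.2 - ψ z.2) ∧
      ∀ ε : ℝ≥0∞, ε ≠ 0 → ∃ π ∈ transportPlans μ ν, ∫⁻ z, d z ∂π ≤ ε := by
  classical
  obtain ⟨hadm, hφ, hψ, hmax⟩ := h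
  let φ₀ := hφ.1.mk φ
  let ψ₀ := hψ.1.mk ψ
  have hφ₀ : Measurable φ₀ := hφ.1.stronglyMeasurable_mk.measurable
  have hψ₀ : Measurable ψ₀ := hψ.1.stronglyMeasurable_mk.measurable
  have hφae : ∀ᵐ x ∂μ, φ x = φ₀ x := hφ.1.ae_eq_mk
  have hψae : ∀ᵐ y ∂ν, ψ y = ψ₀ y := hψ.1.ae_eq_mk
  let d : X × Y → ℝ≥0 := fun z => (φ₀ z.1 + c z.1 z.2 - ψ₀ z.2).toNNReal
  have hd : Measurable d := (((hφ₀.comp measurable_fst).add hc).sub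
    (hψ₀.comp measurable_snd)).real_toNNReal
  have hdgood : ∀ x y, φ x = φ₀ x → ψ y = ψ₀ y → (d (x, y) : ℝ) = φ x + c x y - ψ y := by
    intro x y hx hy
    simp only [d]
    rw [← hx, ← hy, Real.coe_toNNReal]
    have : ψ y - φ x ≤ c x y := hadm x y
    linarith
  refine ⟨d, hd, fun π hπ => ?_, fun ε hε => ?_⟩
  · have h1 : ∀ᵐ z ∂π, φ z.1 = φ₀ z.1 := by
      rw [← hπ.1] at hφae
      exact ae_of_ae_map measurable_fst.aemeasurable hφae
    have h2 : ∀ᵐ z ∂π, ψ z.2 = ψ₀ z.2 := by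
      rw [← hπ.2] at hψae
      exact ae_of_ae_map measurable_snd.aemeasurable hψae
    filter_upwards [h1, h2] with z hz1 hz2 using hdgood z.1 z.2 hz1 hz2
  · refine exists_plan_lintegral_le hd (fun n ε hε => exists_plan_lintegral_min_le hd ?_ n hε) hε
    -- a bounded pair below `d` perturbs `(φ, ψ)` to a competitor; on the null sets where `φ`, `ψ`
    -- differ from their Borel versions, the competitor is shifted by a bound of the pair
    rintro u w hu hw ⟨B₁, hB₁⟩ ⟨B₂, hB₂⟩ huw
    let φ' : X → ℝ := fun x => if φ x = φ₀ x then φ x - u x else φ x + B₂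
    let ψ' : Y → ℝ := fun y => if ψ y = ψ₀ y then ψ y + w y else ψ y - max B₁ B₂
    have hui : Integrable u μ := integrable_of_abs_le hu B₁ hB₁
    have hwi : Integrable w ν := integrable_of_abs_le hw B₂ hB₂
    have hφ'ae : (fun x => φ x - u x) =ᵐ[μ] φ' := by
      filter_upwards [hφae] with x hx
      simp only [φ', if_pos hx]
    have hψ'ae : (fun y => ψ y + w y) =ᵐ[ν] ψ' := by
      filter_upwards [hψae] with y hy
      simp only [ψ', if_pos hy]
    have hadm' : (φ', ψ') ∈ admissiblePairs c := by
      intro x y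
      have h0 : ψ y - φ x ≤ c x y := hadm x y
      have hwB := (abs_le.1 (hB₂ y)).2
      have huB := (abs_le.1 (hB₁ x)).2
      have hw0 := abs_nonneg (w y) |>.trans (hB₂ y)
      have hB := le_max_left B₁ B₂
      have hB' := le_max_right B₁ B₂
      simp only [φ', ψ']
      split_ifs with hy hx hx
      · have h1 := huw x y
        rw [hdgood x y hx hy] at h1
        linarith
      · linarith
      · linarith
      · linarith
    have hle := hmax φ' ψ' hadm' ((hφ.sub hui).congr hφ'ae) ((hψ.add hwi).congr hψ'ae)
    rw [dualValue, dualValue, ← integral_congr_ae hφ'ae, ← integral_congr_ae hψ'ae,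
      integral_sub hφ hui, integral_add hψ hwi] at hle
    linarith

lemma SolvesKR.kantorovichCost_eq (hc : Measurable fun z : X × Y => c z.1 z.2)
    (hbdd : ∃ K : ℝ, ∀ x y, K ≤ c x y) (h : SolvesKR c μ ν φ ψ) :
    kantorovichCost c μ ν = ((dualValue μ ν φ ψ : ℝ) : EReal) := by
  refine le_antisymm ?_ (dualValue_le_kantorovichCost hc hbdd h.1 h.2.1 h.2.2.1)
  obtain ⟨d, hd, hdae, hplan⟩ := h.exists_reduced_cost hc
  obtain ⟨-, hφ, hψ, -⟩ := h
  by_contra! hlt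
  obtain ⟨r, hr1, hr2⟩ := EReal.lt_iff_exists_real_btwn.1 hlt
  have hpos : 0 < r - dualValue μ ν φ ψ := sub_pos.2 (EReal.coe_lt_coe_iff.1 hr1)
  obtain ⟨π, hπ, hle⟩ := hplan (ENNReal.ofReal (r - dualValue μ ν φ ψ)) (by simpa using hpos)
  have hφπ := integrable_fst_of_mem_transportPlans hπ hφ
  have hψπ := integrable_snd_of_mem_transportPlans hπ hψ
  have hdint : Integrable (fun z => (d z : ℝ)) π := by
    refine ⟨hd.coe_nnreal_real.aestronglyMeasurable, ?_⟩
    rw [hasFiniteIntegral_iff_ofReal (ae_of_all _ fun z => (d z).coe_nonneg)]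
    simp only [ENNReal.ofReal_coe_nnreal]
    exact hle.trans_lt ENNReal.ofReal_lt_top
  have hdle : ∫ z, (d z : ℝ) ∂π ≤ r - dualValue μ ν φ ψ := by
    rw [integral_eq_lintegral_of_nonneg_ae (ae_of_all _ fun z => (d z).coe_nonneg) hdint.1]
    simp only [ENNReal.ofReal_coe_nnreal]
    exact ENNReal.toReal_le_of_le_ofReal hpos.le hle
  have hcae : (fun z : X × Y => (d z : ℝ) + (ψ z.2 - φ z.1)) =ᵐ[π] fun z => c z.1 z.2 := by
    filter_upwards [hdae π hπ] with z hz
    rw [hz]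
    ring
  have hcint : Integrable (fun z : X × Y => c z.1 z.2) π := (hdint.add (hψπ.sub hφπ)).congr hcae
  have hcle : ∫ z, c z.1 z.2 ∂π ≤ r := by
    have hψφ : Integrable (fun z => ψ z.2 - φ z.1) π := hψπ.sub hφπ
    rw [← integral_congr_ae hcae, integral_add hdint hψφ, integral_sub hψπ hφπ,
      integral_fst_of_mem_transportPlans hπ hφ, integral_snd_of_mem_transportPlans hπ hψ]
    change _ + dualValue μ ν φ ψ ≤ r
    linarith
  have hcost : kantorovichCost c μ ν ≤ r := by
    refine (iInf₂_le π hπ).trans ?_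
    rw [extIntegral_of_integrable hcint]
    exact EReal.coe_le_coe_iff.2 hcle
  exact absurd hr2 (not_lt.2 hcost)

/-- At a maximizer, `ψ` coincides with `T⁻φ` almost everywhere: disintegrating plans of small
reduced cost bounds the (possibly nonmeasurable) difference `T⁻φ - ψ` by measurable functions of
small integral. -/
lemma SolvesKR.Tminus_ae_eq (hc : Measurable fun z : X × Y => c z.1 z.2)
    (h : SolvesKR c μ ν φ ψ) : Tminus c φ =ᵐ[ν] ψ := by
  obtain ⟨d, hd, hdae, hplan⟩ := h.exists_reduced_cost hc
  obtain ⟨hadm, -, -, -⟩ := h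
  have hX : Nonempty X := nonempty_of_isProbabilityMeasure μ
  have hbelow : ∀ y x, ψ y ≤ φ x + c x y := fun y x => sub_le_iff_le_add'.1 (hadm x y)
  have hb : ∀ y, BddBelow (range fun x => φ x + c x y) := fun y =>
    ⟨ψ y, by rintro _ ⟨x, rfl⟩; exact hbelow y x⟩
  have hg : ∀ n : ℕ, ∃ g : Y → ℝ≥0∞, Measurable g ∧ ∫⁻ y, g y ∂ν ≤ ((n : ℝ≥0∞) + 1)⁻¹ ∧
      ∀ᵐ y ∂ν, ENNReal.ofReal (Tminus c φ y - ψ y) ≤ g y := by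
    intro n
    obtain ⟨π, hπ, hle⟩ := hplan ((n : ℝ≥0∞) + 1)⁻¹ (by simp)
    have := isProbabilityMeasure_of_mem_transportPlans hπ
    let π' := π.map Prod.swap
    have hπ' : IsProbabilityMeasure π' :=
      Measure.isProbabilityMeasure_map measurable_swap.aemeasurable
    have hfst : π'.fst = ν := by
      rw [Measure.fst, Measure.map_map measurable_fst measurable_swap]
      exact hπ.2
    have hdis := π'.disintegrate π'.condKernel
    rw [hfst] at hdis
    have hds : Measurable fun z : Y × X => (d z.swap : ℝ≥0∞) :=
      (hd.comp measurable_swap).coe_nnreal_ennreal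
    refine ⟨fun y => ∫⁻ x, d (x, y) ∂(π'.condKernel y), hds.lintegral_kernel_prod_right', ?_, ?_⟩
    · calc ∫⁻ y, ∫⁻ x, d (x, y) ∂(π'.condKernel y) ∂ν
          = ∫⁻ z, d z.swap ∂(ν.compProd π'.condKernel) := (Measure.lintegral_compProd hds).symm
        _ = ∫⁻ z, d z ∂π := by
          rw [hdis, lintegral_map hds measurable_swap]
          simp
        _ ≤ _ := hle
    · have hae : ∀ᵐ z ∂π', (d z.swap : ℝ) = φ z.2 + c z.2 z.1 - ψ z.1 := by
        refine (MeasurableEquiv.prodComm.measurableEmbedding.ae_map_iff (μ := π)).2 ?_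
        exact hdae π hπ
      rw [← hdis] at hae
      filter_upwards [Measure.ae_ae_of_ae_compProd hae] with y hy
      calc ENNReal.ofReal (Tminus c φ y - ψ y)
          = ∫⁻ _, ENNReal.ofReal (Tminus c φ y - ψ y) ∂(π'.condKernel y) := by simp
        _ ≤ ∫⁻ x, d (x, y) ∂(π'.condKernel y) := by
          refine lintegral_mono_ae ?_
          filter_upwards [hy] with x hx
          rw [← ENNReal.ofReal_coe_nnreal]
          refine ENNReal.ofReal_le_ofReal ?_
          change (d (x, y) : ℝ) = φ x + c x y - ψ y at hx
          rw [hx]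
          exact sub_le_sub_right (ciInf_le (hb y) x) _
  choose g hgm hgint hgle using hg
  have hzero : ∫⁻ y, ⨅ n, g n y ∂ν = 0 := by
    refine le_antisymm (ENNReal.le_of_forall_pos_le_add fun ε hε _ => ?_) zero_le
    obtain ⟨n, hn⟩ := ENNReal.exists_inv_nat_lt (a := (ε : ℝ≥0∞)) (by exact_mod_cast hε.ne')
    rw [zero_add]
    calc ∫⁻ y, ⨅ n, g n y ∂ν ≤ ∫⁻ y, g n y ∂ν := lintegral_mono fun y => iInf_le _ n
      _ ≤ ((n : ℝ≥0∞) + 1)⁻¹ := hgint n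
      _ ≤ (n : ℝ≥0∞)⁻¹ := ENNReal.inv_le_inv.2 le_self_add
      _ ≤ ε := hn.le
  have hae0 := (lintegral_eq_zero_iff (Measurable.iInf hgm)).1 hzero
  filter_upwards [hae0, ae_all_iff.2 hgle] with y hy0 hy
  have h1 : ENNReal.ofReal (Tminus c φ y - ψ y) ≤ 0 := (le_iInf hy).trans hy0.le
  have h2 : Tminus c φ y - ψ y ≤ 0 := by simpa using h1
  exact le_antisymm (by linarith) (le_ciInf (hbelow y))

lemma SolvesKR.solvesKminus (hc : Measurable fun z : X × Y => c z.1 z.2)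
    (hbdd : ∃ K : ℝ, ∀ x y, K ≤ c x y) (h : SolvesKR c μ ν φ ψ) : SolvesKminus c μ ν φ := by
  have hae := h.Tminus_ae_eq hc
  have hcost := h.kantorovichCost_eq hc hbdd
  obtain ⟨hadm, hφ, hψ, -⟩ := h
  refine ⟨hφ, fun y => ⟨ψ y, ?_⟩, hψ.congr hae.symm, ?_⟩
  · rintro _ ⟨x, rfl⟩
    exact sub_le_iff_le_add'.1 (hadm x y)
  · rw [iInf_extIntegral_add hc hbdd hφ, hcost, ← EReal.coe_add, integral_congr_ae hae, dualValue,
      add_sub_cancel]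

end Strong

/-! ### Exchanging the two spaces -/

lemma Tminus_neg {X Y : Type*} {c : X → Y → ℝ} {ψ : Y → ℝ} (x : X) :
    Tminus (fun y x => c x y) (-ψ) x = -Tplus c ψ x := by
  simp only [Tminus, Tplus, Pi.neg_apply, iInf, iSup]
  rw [← Real.sInf_neg]
  congr 1
  ext r
  simp only [mem_range, Set.mem_neg]
  exact exists_congr fun y => ⟨fun h => by linarith, fun h => by linarith⟩

section Swap

variable {X Y : Type*} [MeasurableSpace X] [MeasurableSpace Y] {μ : Measure X} {ν : Measure Y}
  {c : X → Y → ℝ} {φ : X → ℝ} {ψ : Y → ℝ}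

lemma map_swap_mem_transportPlans {π : Measure (X × Y)} (hπ : π ∈ transportPlans μ ν) :
    π.map Prod.swap ∈ transportPlans ν μ := by
  constructor
  · rw [Measure.map_map measurable_fst measurable_swap]; exact hπ.2
  · rw [Measure.map_map measurable_snd measurable_swap]; exact hπ.1

lemma extIntegral_map_swap (π : Measure (X × Y)) (f : Y × X → ℝ) :
    extIntegral (π.map Prod.swap) f = extIntegral π fun z => f z.swap := by
  have key : ∀ g : Y × X → ℝ≥0∞, ∫⁻ z, g z ∂(π.map Prod.swap) = ∫⁻ z, g z.swap ∂π := fun g =>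
    MeasurableEquiv.prodComm.measurableEmbedding.lintegral_map g
  simp only [extIntegral, key]

lemma iInf_transportPlans_swap (F : X × Y → ℝ) :
    ⨅ π ∈ transportPlans ν μ, extIntegral π (fun z => F z.swap) =
      ⨅ π ∈ transportPlans μ ν, extIntegral π F := by
  refine le_antisymm (le_iInf₂ fun π hπ => ?_) (le_iInf₂ fun π hπ => ?_)
  · refine (iInf₂_le _ (map_swap_mem_transportPlans hπ)).trans ?_
    rw [extIntegral_map_swap]
    simp
  · refine (iInf₂_le _ (map_swap_mem_transportPlans hπ)).trans ?_
    rw [extIntegral_map_swap]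

lemma kantorovichCost_swap : kantorovichCost (fun y x => c x y) ν μ = kantorovichCost c μ ν :=
  iInf_transportPlans_swap fun z : X × Y => c z.1 z.2

lemma dualValue_neg_neg : dualValue ν μ (-ψ) (-φ) = dualValue μ ν φ ψ := by
  simp only [dualValue, Pi.neg_apply, integral_neg]
  ring

/-- The dual problem is invariant under exchanging the spaces and the signs of the potentials. -/
lemma SolvesKR.swap (h : SolvesKR c μ ν φ ψ) : SolvesKR (fun y x => c x y) ν μ (-ψ) (-φ) := by
  obtain ⟨hadm, hφ, hψ, hmax⟩ := h
  refine ⟨fun y x => ?_, hψ.neg, hφ.neg, fun ψ' φ' h' hψ' hφ' => ?_⟩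
  · have : ψ y - φ x ≤ c x y := hadm x y
    simp only [Pi.neg_apply]
    linarith
  · have e : dualValue ν μ ψ' φ' = dualValue μ ν (-φ') (-ψ') := dualValue_neg_neg.symm
    rw [dualValue_neg_neg, e]
    refine hmax (-φ') (-ψ') (fun x y => ?_) hφ'.neg hψ'.neg
    have : φ' x - ψ' y ≤ c x y := h' y x
    simp only [Pi.neg_apply]
    linarith

lemma solvesKplus_iff [IsProbabilityMeasure μ] (hbdd : ∃ K : ℝ, ∀ x y, K ≤ c x y) :
    SolvesKplus c μ ν ψ ↔ SolvesKminus (fun y x => c x y) ν μ (-ψ) := by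
  have hT : Tminus (fun y x => c x y) (-ψ) = -Tplus c ψ := funext Tminus_neg
  have hrange : ∀ x, BddBelow (range fun y => (-ψ) y + c x y) ↔
      BddAbove (range fun y => ψ y - c x y) := by
    intro x
    rw [← bddBelow_neg]
    have : -range (fun y => ψ y - c x y) = range fun y => (-ψ) y + c x y := by
      ext r
      simp only [mem_range, Set.mem_neg, Pi.neg_apply]
      exact exists_congr fun y => ⟨fun h => by linarith, fun h => by linarith⟩
    rw [this]
  obtain ⟨K, hK⟩ := hbdd
  rw [SolvesKplus, SolvesKminus, hT, integrable_neg_iff, integrable_neg_iff]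
  refine and_congr_right fun hψ => and_congr (forall_congr' fun x => (hrange x).symm)
    (and_congr_right fun _ => ?_)
  have hsup : ⨆ π ∈ transportPlans μ ν, extIntegral π (fun z => ψ z.2 - c z.1 z.2) =
      -⨅ π ∈ transportPlans ν μ, extIntegral π (fun z => (-ψ) z.1 + c z.2 z.1) := by
    have e := iInf_transportPlans_swap (μ := μ) (ν := ν) fun z : X × Y => (-ψ) z.2 + c z.1 z.2
    simp only [Prod.fst_swap, Prod.snd_swap] at e
    rw [e]
    have hneg : ∀ π ∈ transportPlans μ ν, extIntegral π (fun z => ψ z.2 - c z.1 z.2) =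
        -extIntegral π fun z => (-ψ) z.2 + c z.1 z.2 := by
      intro π hπ
      have := isProbabilityMeasure_of_mem_transportPlans hπ
      rw [← extIntegral_neg (f := fun z : X × Y => (-ψ) z.2 + c z.1 z.2)
        (g := fun z => (-ψ) z.2 + K)
        ((integrable_snd_of_mem_transportPlans hπ hψ).neg.add (integrable_const K))
        (ae_of_all _ fun z => add_le_add (le_refl _) (hK z.1 z.2))]
      congr 1
      ext z
      simp only [Pi.neg_apply]
      ring
    refine le_antisymm (iSup₂_le fun π hπ => ?_) ?_
    · rw [hneg π hπ, EReal.neg_le_neg_iff]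
      exact iInf₂_le π hπ
    · rw [EReal.neg_le]
      refine le_iInf₂ fun π hπ => ?_
      rw [EReal.neg_le, ← hneg π hπ]
      exact le_iSup₂ (f := fun π _ => extIntegral π fun z => ψ z.2 - c z.1 z.2) π hπ
  rw [hsup, ← neg_inj, neg_neg]
  simp only [Pi.neg_apply, integral_neg, EReal.coe_neg]

end Swap

end KantorovichLaxOleinik

theorem mainTheorem1 {X Y : Type*}
    [TopologicalSpace X] [PolishSpace X] [MeasurableSpace X] [BorelSpace X]
    [TopologicalSpace Y] [PolishSpace Y] [MeasurableSpace Y] [BorelSpace Y]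
    (c : X → Y → ℝ) (hc : Measurable (fun z : X × Y => c z.1 z.2))
    (hbdd : ∃ K : ℝ, ∀ x y, K ≤ c x y)
    (μ : Measure X) [IsProbabilityMeasure μ] (ν : Measure Y) [IsProbabilityMeasure ν] :
    ((∀ φ : X → ℝ, KantorovichLaxOleinik.SolvesKminus c μ ν φ →
        KantorovichLaxOleinik.SolvesKR c μ ν φ (KantorovichLaxOleinik.Tminus c φ) ∧
        ((KantorovichLaxOleinik.dualValue μ ν φ (KantorovichLaxOleinik.Tminus c φ) : ℝ) : EReal) =
          KantorovichLaxOleinik.kantorovichCost c μ ν) ∧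
      (∀ (φ : X → ℝ) (ψ : Y → ℝ), KantorovichLaxOleinik.SolvesKR c μ ν φ ψ →
        KantorovichLaxOleinik.SolvesKminus c μ ν φ)) ∧
    ((∀ ψ : Y → ℝ, KantorovichLaxOleinik.SolvesKplus c μ ν ψ →
        KantorovichLaxOleinik.SolvesKR c μ ν (KantorovichLaxOleinik.Tplus c ψ) ψ ∧
        ((KantorovichLaxOleinik.dualValue μ ν (KantorovichLaxOleinik.Tplus c ψ) ψ : ℝ) : EReal) =
          KantorovichLaxOleinik.kantorovichCost c μ ν) ∧
      (∀ (φ : X → ℝ) (ψ : Y → ℝ), KantorovichLaxOleinik.SolvesKR c μ ν φ ψ →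
        KantorovichLaxOleinik.SolvesKplus c μ ν ψ)) := by
  have hc' : Measurable fun z : Y × X => c z.2 z.1 := hc.comp measurable_swap
  have hbdd' : ∃ K : ℝ, ∀ y x, K ≤ c x y := hbdd.imp fun K hK y x => hK x y
  refine ⟨⟨fun φ h => h.solvesKR hc hbdd, fun φ ψ h => h.solvesKminus hc hbdd⟩,
    fun ψ h => ?_, fun φ ψ h => ?_⟩
  · obtain ⟨h1, h2⟩ :=
      ((KantorovichLaxOleinik.solvesKplus_iff hbdd).1 h).solvesKR (c := fun y x => c x y) hc' hbdd'
    have hT : KantorovichLaxOleinik.Tminus (fun y x => c x y) (-ψ)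
        = -KantorovichLaxOleinik.Tplus c ψ := funext KantorovichLaxOleinik.Tminus_neg
    rw [hT] at h1 h2
    rw [KantorovichLaxOleinik.dualValue_neg_neg, KantorovichLaxOleinik.kantorovichCost_swap] at h2
    have h3 := h1.swap
    rw [neg_neg, neg_neg] at h3
    exact ⟨h3, h2⟩
  · exact (KantorovichLaxOleinik.solvesKplus_iff hbdd).2
      (h.swap.solvesKminus (c := fun y x => c x y) hc' hbdd')
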